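/- **Theorem (Global convergence).** Let $m\ge 1$, let $\mathcal H_1,\dots,\mathcal H_m$ be finite-dimensional real Hilbert spaces and let $\mathcal H=\mathcal H_1\times\dots\times\mathcal H_m$ carry the product Hilbert structure. Let $S_i\subseteq\mathcal H_i$ be closed, $S=S_1\times\dots\times S_m$, $h\colon\mathcal H\to[-\infty,+\infty]$ with $-h$ proper and lower semicontinuous, and $f_i,g_i\colon\mathcal H_i\to\mathbb R$. Consider the problem of maximizing over $S$ the function $$F(\mathbf x)=h(\mathbf x)+\sum_{i=1}^m\frac{f_i(x_i)}{g_i(x_i)} .$$ *Notation.* $\delta_S$ is $0$ on $S$ and $+\infty$ elsewhere. For $\varphi\colon\mathcal X\to[-\infty,+\infty]$ on a Hilbert space and $|\varphi(x)|<\infty$, $\widehat\partial\varphi(x)$ is the set of $u$ with $\liminf_{z\to x,\,z\neq x}\frac{\varphi(z)-\varphi(x)-\langle u,z-x\rangle}{\|z-x\|}\ge 0$, and $\partial_L\varphi(x)$ is the set of limits of sequences $u_k\in\widehat\partial\varphi(x_k)$ with $x_k\to x$ and $\varphi(x_k)\to\varphi(x)$; $\operatorname{dom}\partial_L\varphi=\{x:\partial_L\varphi(x)\ne\varnothing\}$.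 A point $\mathbf x\in S$ is *stationary* if $0\in\partial_L(-F+\delta_S)(\mathbf x)$. The function $\varphi$ has the *KL property* at $\bar x\in\operatorname{dom}\partial_L\varphi$ if there are a neighbourhood $U$ of $\bar x$, $\eta\in(0,+\infty]$ and a continuous concave $\psi\colon[0,\eta)\to\mathbb R_+$ with $\psi(0)=0$, $\psi$ of class $C^1$ with $\psi'>0$ on $(0,\eta)$, such that $\psi'(\varphi(x)-\varphi(\bar x))\operatorname{dist}(0,\partial_L\varphi(x))\ge 1$ for all $x\in U$ with $\varphi(\bar x)<\varphi(x)<\varphi(\bar x)+\eta$ (where $\operatorname{dist}(0,\varnothing)=+\infty$); it has *exponent* $\alpha\in[0,1)$ there if one can take $\psi(s)=\gamma s^{1-\alpha}$ with some $\gamma>0$. *Standing assumption.* For each $i$: $f_i$ and $g_i$ are locally Lipschitz on an open set containing $S_i$; $f_i\ge0$ on an open set containing $S_i$ and $g_i>0$ on $S_i$; and there are $\alpha_i,\beta_i\ge0$ such that for all $x,z\in S_i$, $$\Big\langle \tfrac{u}{2\sqrt{f_i(x)}},z-x\Big\rangle\le\sqrt{f_i(z)}-\sqrt{f_i(x)}+\tfrac{\alpha_i}{2}\|z-x\|^2\quad\text{for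 all }u\in\partial_Lf_i(x)\text{, if }f_i(x)>0,$$ $$\langle v,z-x\rangle\ge g_i(z)-g_i(x)-\tfrac{\beta_i}{2}\|z-x\|^2\quad\text{for all }v\in\partial_Lg_i(x).$$ *Algorithm.* Let $\delta>0$, $\overline\nu\in[0,\delta/2)$, and $\mathbf x_{-1}=\mathbf x_0\in S$ with $h(\mathbf x_0)>-\infty$. For every $n\ge0$ put $y_{i,n}=\sqrt{f_i(x_{i,n})}/g_i(x_{i,n})$, choose $\tau_n\ge\delta+\max_i\frac12(2y_{i,n}\alpha_i+y_{i,n}^2\beta_i)$, $\nu_n\in[0,\overline\nu/\tau_n]$, $u_{i,n}\in\partial_Lf_i(x_{i,n})$, $v_{i,n}\in\partial_Lg_i(x_{i,n})$, put $z_{i,n}=x_{i,n}+\nu_n(x_{i,n}-x_{i,n-1})$, $w_{i,n}=y_{i,n}\frac{u_{i,n}}{\sqrt{f_i(x_{i,n})}}-y_{i,n}^2v_{i,n}$ if $f_i(x_{i,n})>0$ and $w_{i,n}=0$ if $f_i(x_{i,n})=0$, and, successively for $i=1,\dots,m$, let $x_{i,n+1}$ be a maximizer over $x_i\in S_i$ of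 $$h(x_{1,n+1},\dots,x_{i-1,n+1},x_i,x_{i+1,n},\dots,x_{m,n})-\tau_n\Big\|x_i-z_{i,n}-\tfrac1{2\tau_n}w_{i,n}\Big\|^2 .$$ Let $(\mathbf x_n)_{n\in\mathbb N}$ be a sequence generated in this way. Suppose that $F$ is bounded from above on $S$; that $\{\mathbf x\in S:F(\mathbf x)\ge F(\mathbf x_0)\}$ is bounded; that each $f_i$ and $g_i$ is continuously differentiable on an open set containing $S_i$; that $$G(\mathbf x,\mathbf u):=-F(\mathbf x)+\delta_S(\mathbf x)+\overline\nu\|\mathbf x-\mathbf u\|^2$$ has the KL property at $(\overline{\mathbf x},\overline{\mathbf x})$ for all $\overline{\mathbf x}\in\operatorname{dom}\partial_L(-F+\delta_S)$; that $\limsup_n\tau_n<+\infty$; that either $m=1$, or $h$ is real-valued and differentiable on an open set containing $S$ with $\nabla h$ Lipschitz continuous on $S$; and that there exist $\varepsilon,\ell>0$ such that for all $i$ and all $x,x'\in S_i$ with $\|x-x'\|\le\varepsilon$, $$\Big\|\nabla\Big(\frac{f_i}{g_i}\Big)(x)-\nabla\Big(\frac{f_i}{g_i}\Big)(x')\Big\|\le\ell\|x-x'\|.$$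 Then $\sum_{n\ge0}\|\mathbf x_{n+1}-\mathbf x_n\|<+\infty$ and $(\mathbf x_n)$ converges to a stationary point $\mathbf x^*$. Moreover, if $\alpha\in[0,1)$ and $G$ has the KL property with exponent $\alpha$ at $(\overline{\mathbf x},\overline{\mathbf x})$ for all $\overline{\mathbf x}\in\operatorname{dom}\partial_L(-F+\delta_S)$, then: 1. if $\alpha=0$, there is $n_0$ with $\mathbf x_n=\mathbf x^*$ for all $n\ge n_0$; 2. if $\alpha\in(0,\frac12]$, there are $\gamma>0$ and $\rho\in(0,1)$ such that $\|\mathbf x_n-\mathbf x^*\|\le\gamma\rho^{n/2}$ and $|F(\mathbf x_n)-F(\mathbf x^*)|\le\gamma\rho^n$ for all $n\in\mathbb N$; 3. if $\alpha\in(\frac12,1)$, there is $\gamma>0$ such that $\|\mathbf x_n-\mathbf x^*\|\le\gamma n^{-\frac{1-\alpha}{2\alpha-1}}$ and $|F(\mathbf x_n)-F(\mathbf x^*)|\le\gamma n^{-\frac{2-2\alpha}{2\alpha-1}}$ for all $n\ge1$. -/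

import Mathlib

open Filter Topology
open scoped InnerProductSpace

noncomputable section

namespace SumOfRatios

section Subdifferentials

variable {E : Type*} [NormedAddCommGroup E] [InnerProductSpace ℝ E]

/-- The indicator function `δ_C`: `0` on `C` and `+∞` outside. -/
def indicatorFn (C : Set E) (x : E) : EReal :=
  open Classical in if x ∈ C then 0 else ⊤

/-- A function is proper if it never equals `-∞` and is not identically `+∞`. -/
def IsProper (f : E → EReal) : Prop :=
  (∀ x, f x ≠ ⊥) ∧ ∃ x, f x < ⊤

/-- The Fréchet subdifferential: `|f x| < ∞` and
`liminf_{z → x} (f z - f x - ⟪u, z - x⟫) / ‖z - x‖ ≥ 0`, in the `ε`-form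
`f z ≥ f x + ⟪u, z - x⟫ - ε ‖z - x‖` for all `z` near `x`. -/
def frechetSubdiff (f : E → EReal) (x : E) : Set E :=
  {u | f x ≠ ⊥ ∧ f x ≠ ⊤ ∧ ∀ ε : ℝ, 0 < ε → ∀ᶠ z in 𝓝 x,
    (((f x).toReal + ⟪u, z - x⟫_ℝ - ε * ‖z - x‖ : ℝ) : EReal) ≤ f z}

/-- The limiting subdifferential `∂_L f`. -/
def limitingSubdiff (f : E → EReal) (x : E) : Set E :=
  {u | f x ≠ ⊥ ∧ f x ≠ ⊤ ∧ ∃ (xs us : ℕ → E),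
    Tendsto xs atTop (𝓝 x) ∧ Tendsto (fun k => f (xs k)) atTop (𝓝 (f x)) ∧
    Tendsto us atTop (𝓝 u) ∧ ∀ k, us k ∈ frechetSubdiff f (xs k)}

/-- The domain of `∂_L f`. -/
def domSubdiff (f : E → EReal) : Set E :=
  {x | (limitingSubdiff f x).Nonempty}

/-- `φ` is a desingularization function for `f` at `xbar`, on some interval `[0, η)` with
`η ∈ (0, +∞]` and some neighbourhood `U` of `xbar`. The distance to the empty set is `+∞`. -/
def IsDesingularizing (f : E → EReal) (xbar : E) (φ : ℝ → ℝ) : Prop :=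
  ∃ U ∈ 𝓝 xbar, ∃ η : EReal, 0 < η ∧
    (∀ s : ℝ, 0 ≤ s → (s : EReal) < η → 0 ≤ φ s) ∧
    φ 0 = 0 ∧
    ContinuousOn φ {s : ℝ | 0 ≤ s ∧ (s : EReal) < η} ∧
    ConcaveOn ℝ {s : ℝ | 0 ≤ s ∧ (s : EReal) < η} φ ∧
    ContDiffOn ℝ 1 φ {s : ℝ | 0 < s ∧ (s : EReal) < η} ∧
    (∀ s : ℝ, 0 < s → (s : EReal) < η → 0 < deriv φ s) ∧
    ∀ x ∈ U, f xbar < f x → f x < f xbar + η →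
      1 ≤ ENNReal.ofReal (deriv φ (f x - f xbar).toReal) *
        Metric.infEDist 0 (limitingSubdiff f x)

/-- The Kurdyka–Łojasiewicz property of `f` at `xbar ∈ dom ∂_L f`. -/
def KLAt (f : E → EReal) (xbar : E) : Prop :=
  xbar ∈ domSubdiff f ∧ ∃ φ : ℝ → ℝ, IsDesingularizing f xbar φ

/-- The KL property of `f` at `xbar ∈ dom ∂_L f` with exponent `α`. -/
def KLAtWithExponent (f : E → EReal) (xbar : E) (α : ℝ) : Prop :=
  xbar ∈ domSubdiff f ∧
    ∃ γ : ℝ, 0 < γ ∧ IsDesingularizing f xbar (fun s => γ * s ^ (1 - α))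

end Subdifferentials

section Problem

variable {m : ℕ} {H : Fin m → Type*} [∀ i, NormedAddCommGroup (H i)]
  [∀ i, InnerProductSpace ℝ (H i)]

/-- The product `S = S₁ × ⋯ × S_m`; `PiLp 2 H` is the Hilbert product of the `H i`. -/
def feasible (S : ∀ i, Set (H i)) : Set (PiLp 2 H) :=
  {x | ∀ i, x i ∈ S i}

/-- The objective `F(x) = h(x) + ∑ i, f i (x i) / g i (x i)`. -/
def objective (h : PiLp 2 H → EReal) (f g : ∀ i, H i → ℝ) (x : PiLp 2 H) : EReal :=
  h x + ((∑ i, f i (x i) / g i (x i) : ℝ) : EReal)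

/-- The function `-F + δ_S`. -/
def negObjective (S : ∀ i, Set (H i)) (h : PiLp 2 H → EReal) (f g : ∀ i, H i → ℝ)
    (x : PiLp 2 H) : EReal :=
  -objective h f g x + indicatorFn (feasible S) x

/-- The merit function `G(x, u) = -F(x) + δ_S(x) + νbar ‖x - u‖²` on the Hilbert product. -/
def merit (S : ∀ i, Set (H i)) (h : PiLp 2 H → EReal) (f g : ∀ i, H i → ℝ) (νbar : ℝ)
    (p : WithLp 2 (PiLp 2 H × PiLp 2 H)) : EReal :=
  negObjective S h f g p.fst + ((νbar * ‖p.fst - p.snd‖ ^ 2 : ℝ) : EReal)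

/-- Stationary points of the problem: `x ∈ S` and `0 ∈ ∂_L (-F + δ_S)(x)`. -/
def IsStationary (S : ∀ i, Set (H i)) (h : PiLp 2 H → EReal) (f g : ∀ i, H i → ℝ)
    (x : PiLp 2 H) : Prop :=
  x ∈ feasible S ∧ (0 : PiLp 2 H) ∈ limitingSubdiff (negObjective S h f g) x

/-- The standing assumption on the problem, with constants `a i` for `f i` and `b i` for `g i`. -/
structure StandingAssumption (S : ∀ i, Set (H i)) (h : PiLp 2 H → EReal)
    (f g : ∀ i, H i → ℝ) (a b : Fin m → ℝ) : Prop where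
  closed : ∀ i, IsClosed (S i)
  proper : IsProper (fun x => -h x)
  lsc : LowerSemicontinuous (fun x => -h x)
  lipschitz_f : ∀ i, ∃ O : Set (H i), IsOpen O ∧ S i ⊆ O ∧ LocallyLipschitzOn O (f i)
  lipschitz_g : ∀ i, ∃ O : Set (H i), IsOpen O ∧ S i ⊆ O ∧ LocallyLipschitzOn O (g i)
  nonneg_f : ∀ i, ∃ O : Set (H i), IsOpen O ∧ S i ⊆ O ∧ ∀ x ∈ O, 0 ≤ f i x
  a_nonneg : ∀ i, 0 ≤ a i
  sqrt_f : ∀ i, ∀ x ∈ S i, ∀ z ∈ S i, 0 < f i x →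
    ∀ u ∈ limitingSubdiff (fun y => (f i y : EReal)) x,
      ⟪(2 * √(f i x))⁻¹ • u, z - x⟫_ℝ ≤ √(f i z) - √(f i x) + a i / 2 * ‖z - x‖ ^ 2
  pos_g : ∀ i, ∀ x ∈ S i, 0 < g i x
  b_nonneg : ∀ i, 0 ≤ b i
  upper_g : ∀ i, ∀ x ∈ S i, ∀ z ∈ S i, ∀ v ∈ limitingSubdiff (fun y => (g i y : EReal)) x,
    g i z - g i x - b i / 2 * ‖z - x‖ ^ 2 ≤ ⟪v, z - x⟫_ℝ

/-- `y_i = √(f_i(x_i)) / g_i(x_i)`. -/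
def ratioRoot (f g : ∀ i, H i → ℝ) (x : PiLp 2 H) (i : Fin m) : ℝ :=
  √(f i (x i)) / g i (x i)

/-- The direction `w_i` built from subgradients `u` of `f i` and `v` of `g i` at `x i`. -/
def direction (f g : ∀ i, H i → ℝ) (x : PiLp 2 H) (i : Fin m) (u v : H i) : H i :=
  open Classical in
  if 0 < f i (x i) then
    (ratioRoot f g x i / √(f i (x i))) • u - ratioRoot f g x i ^ 2 • v
  else 0

/-- The point `(x'_1, …, x'_{i-1}, ξ, x_{i+1}, …, x_m)`. -/
def blockPoint (x x' : PiLp 2 H) (i : Fin m) (ξ : H i) : PiLp 2 H :=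
  WithLp.toLp 2 (Function.update (fun j => if j < i then x' j else x j) i ξ)

/-- `x` is a sequence generated by the inertial proximal block coordinate method with parameters
`δ`, `νbar`, stepsizes `τ n` and inertial weights `ν n`. The convention `x_{-1} = x_0` is
built in, because `n - 1 = 0` for `n = 0` in the natural numbers. -/
structure IsGenerated (S : ∀ i, Set (H i)) (h : PiLp 2 H → EReal) (f g : ∀ i, H i → ℝ)
    (a b : Fin m → ℝ) (δ νbar : ℝ) (τ ν : ℕ → ℝ) (x : ℕ → PiLp 2 H) : Prop where
  δ_pos : 0 < δ
  νbar_nonneg : 0 ≤ νbar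
  νbar_lt : νbar < δ / 2
  init_mem : x 0 ∈ feasible S
  τ_ge : ∀ n i, δ + 1 / 2 * (2 * ratioRoot f g (x n) i * a i + ratioRoot f g (x n) i ^ 2 * b i)
    ≤ τ n
  ν_nonneg : ∀ n, 0 ≤ ν n
  ν_le : ∀ n, ν n ≤ νbar / τ n
  step_mem : ∀ n i, x (n + 1) i ∈ S i
  step : ∀ n i, ∃ u ∈ limitingSubdiff (fun y => (f i y : EReal)) (x n i),
    ∃ v ∈ limitingSubdiff (fun y => (g i y : EReal)) (x n i),
      IsMaxOn (fun ξ : H i => h (blockPoint (x n) (x (n + 1)) i ξ) -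
        ((τ n * ‖ξ - (x n i + ν n • (x n i - x (n - 1) i)) -
          (1 / (2 * τ n)) • direction f g (x n) i u v‖ ^ 2 : ℝ) : EReal))
        (S i) (x (n + 1) i)

/-- `h` is real-valued and differentiable on an open set containing `C`, and its gradient is
Lipschitz continuous on `C`. -/
def HasLipschitzGradientOn {E : Type*} [NormedAddCommGroup E] [InnerProductSpace ℝ E]
    [CompleteSpace E] (h : E → EReal) (C : Set E) : Prop :=
  ∃ (O : Set E) (hr : E → ℝ), IsOpen O ∧ C ⊆ O ∧ (∀ x ∈ O, h x = (hr x : EReal)) ∧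
    DifferentiableOn ℝ hr O ∧ ∃ K : NNReal, LipschitzOnWith K (gradient hr) C

end Problem

end SumOfRatios

end

noncomputable section

namespace SumOfRatios

set_option linter.unusedSectionVars false

/-! ### Calculus of Fréchet and limiting subgradients. -/

section Calculus

variable {E : Type*} [NormedAddCommGroup E] [InnerProductSpace ℝ E]

/-! Put `y = √f(x) / g(x)`. Expanding `(√f(z) - y g(z))² ≥ 0` gives `f(z) / g(z) ≥ 2 y √f(z) - y²
g(z)`, with equality at `z = x`. The assumptions on `√f` and `g` turn the right side into a
quadratic minorant of the ratio with slope `w`, whose curvature is dominated by the stepsize with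
margin `δ` (`ratio_minorant`). Maximality of the block steps then makes the merit value `G(x_n,
x_{n-1})` drop by at least `(δ - 2 νbar) ‖x_{n+1} - x_n‖²` (`IsGenerated.descent`).

For continuously differentiable `f i`, `g i` the slope `w` is the gradient of the ratio, so
optimality of a step produces a Fréchet subgradient of `-F + δ_S` at `x_{n+1}` whose norm is of the
order of the last two steps (`exists_small_subgradient`). Blocks are updated at different
intermediate points; for `m > 1` the Lipschitz gradient of `h` pays for that. The bounded level set
provides a cluster point, and `h` converges along the subsequence (`tendsto_coupling`), so the
cluster point is stationary and the merit values tend to its value.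

These facts are packaged in `IsDescentSequence`. With `d_n` the step lengths and `r_n` the merit
gaps, the KL inequality and concavity of `φ` give `d_{n+2} ≤ (d_{n+1} + d_n) / 4 + K (φ(r_{n+2}) -
φ(r_{n+3}))`. The `φ` terms telescope: a late iterate close to the cluster point can no longer
escape, and the total length is finite. For `φ(s) = γ s^(1-α)` with `α > 0` the same ingredients
give `r_{n+2}^(2α) ≤ K (r_n - r_{n+2})`, from which the rates follow by comparison
(`exists_two_step`). For `α = 0` a positive gap would keep the subgradients away from zero. -/

theorem frechetSubdiff_subset_limitingSubdiff (φ : E → EReal) (x : E) :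
    frechetSubdiff φ x ⊆ limitingSubdiff φ x := fun u hu =>
  ⟨hu.1, hu.2.1, fun _ => x, fun _ => u, tendsto_const_nhds, tendsto_const_nhds,
    tendsto_const_nhds, fun _ => hu⟩

theorem eventually_abs_sub_le_of_hasFDerivAt {ψ : E → ℝ} {L : E →L[ℝ] ℝ} {x : E}
    (hψ : HasFDerivAt ψ L x) {ε : ℝ} (hε : 0 < ε) :
    ∀ᶠ z in 𝓝 x, |ψ z - ψ x - L (z - x)| ≤ ε * ‖z - x‖ := by
  filter_upwards [hψ.isLittleO.def hε] with z hz
  simpa using hz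

/-- Sum rule for Fréchet subgradients: one summand is differentiable. -/
theorem add_mem_frechetSubdiff {φ Φ : E → EReal} {ψ : E → ℝ} {L : E →L[ℝ] ℝ} {x u p : E}
    (hu : u ∈ frechetSubdiff φ x) (hψ : HasFDerivAt ψ L x) (hL : ∀ v, L v = ⟪p, v⟫_ℝ)
    (hΦ : ∀ᶠ z in 𝓝 x, Φ z = φ z + (ψ z : EReal)) :
    u + p ∈ frechetSubdiff Φ x := by
  obtain ⟨hb, ht, hu⟩ := hu
  have hx : Φ x = (((φ x).toReal + ψ x : ℝ) : EReal) := by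
    rw [hΦ.self_of_nhds, EReal.coe_add, EReal.coe_toReal ht hb]
  refine ⟨by rw [hx]; exact EReal.coe_ne_bot _, by rw [hx]; exact EReal.coe_ne_top _, ?_⟩
  intro ε hε
  filter_upwards [hΦ, hu (ε / 2) (by positivity),
    eventually_abs_sub_le_of_hasFDerivAt hψ (ε := ε / 2) (by positivity)] with z h1 h2 h3
  rw [h1, hx, EReal.toReal_coe]
  have h4 : (φ x).toReal + ψ x + ⟪u + p, z - x⟫_ℝ - ε * ‖z - x‖ ≤
      ((φ x).toReal + ⟪u, z - x⟫_ℝ - ε / 2 * ‖z - x‖) + ψ z := by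
    rw [inner_add_left, ← hL]
    have := (abs_le.1 h3).1
    linarith
  calc _ ≤ ((((φ x).toReal + ⟪u, z - x⟫_ℝ - ε / 2 * ‖z - x‖) + ψ z : ℝ) : EReal) :=
        EReal.coe_le_coe_iff.2 h4
    _ = (((φ x).toReal + ⟪u, z - x⟫_ℝ - ε / 2 * ‖z - x‖ : ℝ) : EReal) + (ψ z : EReal) :=
        EReal.coe_add _ _
    _ ≤ _ := add_le_add_left h2 _

/-- A proximal subgradient is a Fréchet subgradient. -/
theorem mem_frechetSubdiff_of_proximal {φ : E → EReal} {x u : E} {κ : ℝ}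
    (hb : φ x ≠ ⊥) (ht : φ x ≠ ⊤)
    (h : ∀ z, (((φ x).toReal + ⟪u, z - x⟫_ℝ - κ * ‖z - x‖ ^ 2 : ℝ) : EReal) ≤ φ z) :
    u ∈ frechetSubdiff φ x := by
  refine ⟨hb, ht, fun ε hε => ?_⟩
  have hlim : Tendsto (fun z => κ * ‖z - x‖) (𝓝 x) (𝓝 0) := by
    have : Continuous fun z => κ * ‖z - x‖ := by fun_prop
    simpa using this.tendsto x
  filter_upwards [hlim.eventually_lt_const hε] with z hz
  refine le_trans (EReal.coe_le_coe_iff.2 ?_) (h z)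
  nlinarith [norm_nonneg (z - x)]

/-- If `u` is dominated by `o(‖z - x‖)` against a linear functional, both coincide. -/
theorem eq_of_eventually_inner_le {u p x : E}
    (h : ∀ ε : ℝ, 0 < ε → ∀ᶠ z in 𝓝 x, ⟪u - p, z - x⟫_ℝ ≤ ε * ‖z - x‖) : u = p := by
  by_contra hne
  have hpos : 0 < ‖u - p‖ := norm_pos_iff.2 (sub_ne_zero.2 hne)
  -- The hypothesis is tested on the ray `x + t (u - p)` with `ε = ‖u - p‖ / 2`; it would give `t ‖u
  -- - p‖² ≤ t ‖u - p‖² / 2`.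
  have hline : Tendsto (fun t : ℝ => x + t • (u - p)) (𝓝[>] 0) (𝓝 x) := by
    have : Continuous fun t : ℝ => x + t • (u - p) := by fun_prop
    have h0 := this.tendsto 0
    simp only [zero_smul, add_zero] at h0
    exact h0.mono_left nhdsWithin_le_nhds
  obtain ⟨t, ht, htpos⟩ := ((hline.eventually (h (‖u - p‖ / 2) (by positivity))).and
    self_mem_nhdsWithin).exists
  have htpos : 0 < t := htpos
  simp only [add_sub_cancel_left, inner_smul_right, real_inner_self_eq_norm_sq, norm_smul,
    Real.norm_eq_abs, abs_of_pos htpos] at ht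
  have : 0 < t * ‖u - p‖ ^ 2 := by positivity
  nlinarith

theorem frechetSubdiff_coe_eq {ψ : E → ℝ} {L : E →L[ℝ] ℝ} {x u p : E}
    (hu : u ∈ frechetSubdiff (fun y => (ψ y : EReal)) x) (hψ : HasFDerivAt ψ L x)
    (hL : ∀ v, L v = ⟪p, v⟫_ℝ) : u = p := by
  refine eq_of_eventually_inner_le (x := x) fun ε hε => ?_
  filter_upwards [hu.2.2 (ε / 2) (by positivity),
    eventually_abs_sub_le_of_hasFDerivAt hψ (ε := ε / 2) (by positivity)] with z h1 h2
  have h1 := EReal.coe_le_coe_iff.1 h1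
  simp only [EReal.toReal_coe] at h1
  have := (abs_le.1 h2).2
  rw [inner_sub_left, ← hL]
  linarith

theorem hasFDerivAt_div {f g : E → ℝ} {x : E} {f' g' : E →L[ℝ] ℝ} (hf : HasFDerivAt f f' x)
    (hg : HasFDerivAt g g' x) (h0 : g x ≠ 0) :
    HasFDerivAt (fun y => f y / g y) ((g x)⁻¹ • f' - (f x / g x ^ 2) • g') x := by
  have h1 : HasFDerivAt (fun y => (g y)⁻¹) (-(g x ^ 2)⁻¹ • g') x :=
    (hasDerivAt_inv h0).comp_hasFDerivAt x hg
  simp only [div_eq_mul_inv]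
  refine (hf.mul h1).congr_fderiv ?_
  ext v
  simp
  ring

variable [CompleteSpace E]

theorem fderiv_apply_eq_inner_gradient (ψ : E → ℝ) (x v : E) :
    fderiv ℝ ψ x v = ⟪gradient ψ x, v⟫_ℝ := by
  simp [gradient]

theorem continuousOn_gradient {ψ : E → ℝ} {O : Set E} (hO : IsOpen O)
    (hψ : ContDiffOn ℝ 1 ψ O) : ContinuousOn (gradient ψ) O :=
  (InnerProductSpace.toDual ℝ E).symm.continuous.comp_continuousOn
    (hψ.continuousOn_fderiv_of_isOpen hO le_rfl)

/-- The limiting subdifferential of a continuously differentiable function is its gradient. -/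
theorem eq_gradient_of_mem_limitingSubdiff {ψ : E → ℝ} {O : Set E} (hO : IsOpen O)
    (hψ : ContDiffOn ℝ 1 ψ O) {x u : E} (hx : x ∈ O)
    (hu : u ∈ limitingSubdiff (fun y => (ψ y : EReal)) x) : u = gradient ψ x := by
  obtain ⟨-, -, xs, us, hxs, -, hus, hmem⟩ := hu
  have h1 : Tendsto (fun k => gradient ψ (xs k)) atTop (𝓝 (gradient ψ x)) :=
    ((continuousOn_gradient hO hψ).continuousAt (hO.mem_nhds hx)).tendsto.comp hxs
  refine tendsto_nhds_unique (hus.congr' ?_) h1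
  filter_upwards [hxs (hO.mem_nhds hx)] with k hk
  exact frechetSubdiff_coe_eq (hmem k)
    ((hψ.differentiableOn one_ne_zero).differentiableAt (hO.mem_nhds hk)).hasFDerivAt
    (fderiv_apply_eq_inner_gradient ψ _)

theorem gradient_div {f g : E → ℝ} {x : E} (hf : DifferentiableAt ℝ f x)
    (hg : DifferentiableAt ℝ g x) (h0 : g x ≠ 0) :
    gradient (fun y => f y / g y) x =
      (g x)⁻¹ • gradient f x - (f x / g x ^ 2) • gradient g x := by
  have := (hasFDerivAt_div hf.hasFDerivAt hg.hasFDerivAt h0).fderiv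
  simp [gradient, this]

end Calculus

/-! ### Scalar recursions: finite length, trapping, decay rates. -/

section Sequences

/-- `(A/4 + B)² - A B = (A/4 - B)²`. The weight `1/4` makes the two earlier steps enter the
recursion with total coefficient `1/2 < 1`. -/
theorem le_quarter_add_of_sq_le_mul {d A B : ℝ} (hA : 0 ≤ A) (hB : 0 ≤ B)
    (h : d ^ 2 ≤ A * B) : d ≤ A / 4 + B := by
  have h1 : d ^ 2 ≤ (A / 4 + B) ^ 2 := by nlinarith [sq_nonneg (A / 4 - B)]
  exact (le_abs_self d).trans (abs_le_of_sq_le_sq h1 (by positivity))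

/-- The energy estimate behind the finite length property. -/
theorem sum_le_of_three_term {d s : ℕ → ℝ} {K : ℝ} (N n : ℕ)
    (h : ∀ k < n, d (N + k + 2) ≤ (d (N + k + 1) + d (N + k)) / 4
      + K * (s (N + k + 2) - s (N + k + 3))) :
    ∑ k ∈ Finset.range n, d (N + k) + 3 / 2 * d (N + n) + 2 * d (N + n + 1)
      + 2 * K * s (N + n + 2) ≤ 3 / 2 * d N + 2 * d (N + 1) + 2 * K * s (N + 2) := by
  induction n with
  | zero => simp
  | succ n ih =>
    have h1 := ih fun k hk => h k (by omega)
    -- The energy is `V_n = 3/2 d_n + 2 d_{n+1} + 2 K s_{n+2}`; twice the recursion says exactly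
    -- `V_n - V_{n+1} ≥ d_n`.
    have h2 := h n (by omega)
    rw [Finset.sum_range_succ]
    have e1 : N + (n + 1) = N + n + 1 := by omega
    have e2 : N + (n + 1) + 1 = N + n + 2 := by omega
    have e3 : N + (n + 1) + 2 = N + n + 3 := by omega
    rw [e3, e2, e1]
    linarith

/-- The descent and Kurdyka–Łojasiewicz inequalities imply a three term recursion. -/
theorem three_term_of_desingularizing {φ : ℝ → ℝ} {D : Set ℝ} {c C r r' d d₁ d₂ : ℝ}
    (hc : 0 < c) (hC : 0 ≤ C) (hconc : ConcaveOn ℝ D φ)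
    (hr : r ∈ D) (hr' : r' ∈ D) (hr'0 : 0 ≤ r') (hd : 0 ≤ d₁ + d₂) (hdesc : c * d ^ 2 ≤ r - r')
    (hdiff : 0 < r → DifferentiableAt ℝ φ r) (hder : 0 < r → 0 ≤ deriv φ r)
    (hKL : 0 < r → 1 ≤ deriv φ r * (C * (d₁ + d₂))) :
    d ≤ (d₁ + d₂) / 4 + C / c * (φ r - φ r') := by
  have hrr : r' ≤ r := by nlinarith [sq_nonneg d]
  rcases hrr.eq_or_lt with heq | hlt
  · have : d = 0 := by
      have : c * d ^ 2 ≤ 0 := by linarith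
      have : d ^ 2 ≤ 0 := by nlinarith
      exact pow_eq_zero_iff two_ne_zero |>.1 (le_antisymm this (sq_nonneg _))
    rw [this, heq]
    simp
    linarith
  · have hr0 : 0 < r := by linarith
    -- Concavity: `φ'(r) (r - r') ≤ φ(r) - φ(r')`. Multiplying `c d² ≤ r - r'` by the KL inequality
    -- gives `c d² ≤ C (d₁ + d₂) (φ(r) - φ(r'))`.
    have hslope := hconc.deriv_le_slope hr' hr hlt (hdiff hr0)
    rw [slope_def_field, le_div_iff₀ (by linarith)] at hslope
    have hφ : 0 ≤ φ r - φ r' := le_trans (mul_nonneg (hder hr0) (by linarith)) hslope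
    refine le_quarter_add_of_sq_le_mul hd (by positivity) ?_
    have h1 := hKL hr0
    have h2 : c * d ^ 2 ≤ (C * (d₁ + d₂)) * (φ r - φ r') := by
      calc c * d ^ 2 ≤ (r - r') * 1 := by linarith
        _ ≤ (r - r') * (deriv φ r * (C * (d₁ + d₂))) :=
          mul_le_mul_of_nonneg_left h1 (by linarith)
        _ = (C * (d₁ + d₂)) * (deriv φ r * (r - r')) := by ring
        _ ≤ _ := mul_le_mul_of_nonneg_left hslope (by positivity)
    have h3 : (d₁ + d₂) * (C / c * (φ r - φ r')) = (C * (d₁ + d₂)) * (φ r - φ r') / c := by ring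
    rw [h3, le_div_iff₀ hc]
    linarith

variable {E : Type*} [NormedAddCommGroup E]

theorem norm_sub_le_sum_norm_sub (x : ℕ → E) (N n : ℕ) :
    ‖x (N + n) - x N‖ ≤ ∑ k ∈ Finset.range n, ‖x (N + k + 1) - x (N + k)‖ := by
  induction n with
  | zero => simp
  | succ n ih =>
    rw [Finset.sum_range_succ]
    have : x (N + (n + 1)) - x N = (x (N + n) - x N) + (x (N + n + 1) - x (N + n)) := by
      rw [← add_assoc]; abel
    rw [this]
    exact (norm_add_le _ _).trans (by linarith)

/-- Trapping: a sequence with a three term recursion valid near a cluster point stays there. -/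
theorem eventually_mem_ball_of_three_term {x : ℕ → E} {xs : E} {s : ℕ → ℝ} {K ρ : ℝ} {N₀ : ℕ}
    (hK : 0 ≤ K) (hρ : 0 < ρ) (hs : ∀ n ≥ N₀, 0 ≤ s n) (hs0 : Tendsto s atTop (𝓝 0))
    (hd0 : Tendsto (fun n => ‖x (n + 1) - x n‖) atTop (𝓝 0)) (hcl : MapClusterPt xs atTop x)
    (h : ∀ n ≥ N₀, ‖x (n + 1) - xs‖ < ρ → ‖x (n + 2) - xs‖ < ρ →
      ‖x (n + 3) - x (n + 2)‖ ≤ (‖x (n + 2) - x (n + 1)‖ + ‖x (n + 1) - x n‖) / 4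
        + K * (s (n + 2) - s (n + 3))) :
    ∀ᶠ n in atTop, ‖x n - xs‖ < ρ := by
  set d : ℕ → ℝ := fun n => ‖x (n + 1) - x n‖ with hd
  have hV : Tendsto (fun n => 3 / 2 * d n + 2 * d (n + 1) + 2 * K * s (n + 2)) atTop (𝓝 0) := by
    have := ((hd0.const_mul (3 / 2)).add (((tendsto_add_atTop_iff_nat 1).2 hd0).const_mul 2)).add
      (((tendsto_add_atTop_iff_nat 2).2 hs0).const_mul (2 * K))
    simpa using this
  -- The energy tends to `0` and the iterates return near `xs` infinitely often, so some late `x N`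
  -- has both its distance to `xs` and its energy below `ρ / 2`.
  obtain ⟨N, hN1, hN2, hN3⟩ := ((hcl.frequently (Metric.ball_mem_nhds xs (half_pos hρ)
    )).and_eventually ((hV.eventually_lt_const (half_pos hρ)).and (eventually_ge_atTop N₀))).exists
  rw [dist_eq_norm] at hN1
  have hd_nonneg : ∀ n, 0 ≤ d n := fun n => norm_nonneg _
  -- The energy carries `d (N + n)` and `d (N + n + 1)` with coefficients at least `1`, so it
  -- controls two steps beyond the recursion. This reaches index `N + n + 2`, precisely what the
  -- recursion at `N + n` asks for, and the induction `hrec` closes.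
  have key : ∀ n, (∀ k < n, d (N + k + 2) ≤ (d (N + k + 1) + d (N + k)) / 4
      + K * (s (N + k + 2) - s (N + k + 3))) → ∀ j ≤ n + 2, ‖x (N + j) - xs‖ < ρ := by
    intro n hn j hj
    have h1 := sum_le_of_three_term (d := d) (s := s) N n hn
    have h2 := norm_sub_le_sum_norm_sub x N j
    have h3 : ∑ k ∈ Finset.range j, d (N + k) ≤ ∑ k ∈ Finset.range (n + 2), d (N + k) :=
      Finset.sum_le_sum_of_subset_of_nonneg (Finset.range_mono hj) fun _ _ _ => hd_nonneg _
    rw [Finset.sum_range_succ, Finset.sum_range_succ] at h3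
    have h4 : 0 ≤ 2 * K * s (N + n + 2) := mul_nonneg (by positivity) (hs _ (by omega))
    have h5 := hd_nonneg (N + n)
    have h6 := hd_nonneg (N + n + 1)
    have e : N + (n + 1) = N + n + 1 := by omega
    rw [e] at h3
    have h7 : ‖x (N + j) - xs‖ ≤ ‖x (N + j) - x N‖ + ‖x N - xs‖ :=
      norm_sub_le_norm_sub_add_norm_sub _ _ _
    have h8 : ‖x (N + j) - x N‖ ≤ ∑ k ∈ Finset.range j, d (N + k) := h2
    linarith
  have hrec : ∀ n, ∀ k < n, d (N + k + 2) ≤ (d (N + k + 1) + d (N + k)) / 4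
      + K * (s (N + k + 2) - s (N + k + 3)) := by
    intro n
    induction n with
    | zero => intro k hk; omega
    | succ n ih =>
      intro k hk
      rcases Nat.lt_succ_iff_lt_or_eq.1 hk with hk | rfl
      · exact ih k hk
      · exact h (N + k) (by omega) (key k ih (k + 1) (by omega)) (key k ih (k + 2) (by omega))
  filter_upwards [eventually_ge_atTop N] with n hn
  obtain ⟨j, rfl⟩ := Nat.exists_eq_add_of_le hn
  exact key j (hrec j) j (by omega)

/-- A three term recursion implies summability with a tail estimate. -/
theorem summable_of_three_term {d s : ℕ → ℝ} {K : ℝ} {N₀ : ℕ} (hK : 0 ≤ K) (hd : ∀ n, 0 ≤ d n)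
    (hs : ∀ n ≥ N₀, 0 ≤ s n)
    (h : ∀ n ≥ N₀, d (n + 2) ≤ (d (n + 1) + d n) / 4 + K * (s (n + 2) - s (n + 3))) :
    Summable d ∧ ∀ N ≥ N₀, ∑' k, d (N + k) ≤ 3 / 2 * d N + 2 * d (N + 1) + 2 * K * s (N + 2) := by
  have hb : ∀ N ≥ N₀, ∀ n, ∑ k ∈ Finset.range n, d (N + k) ≤
      3 / 2 * d N + 2 * d (N + 1) + 2 * K * s (N + 2) := by
    intro N hN n
    have h1 := sum_le_of_three_term (d := d) (s := s) N n fun k _ => h (N + k) (by omega)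
    have h4 : 0 ≤ 2 * K * s (N + n + 2) := mul_nonneg (by positivity) (hs _ (by omega))
    linarith [hd (N + n), hd (N + n + 1)]
  have hsum : ∀ N ≥ N₀, Summable fun k => d (N + k) := fun N hN =>
    summable_of_sum_range_le (fun _ => hd _) (hb N hN)
  refine ⟨?_, fun N hN => Real.tsum_le_of_sum_range_le (fun _ => hd _) (hb N hN)⟩
  rw [← summable_nat_add_iff N₀]
  simpa [add_comm] using hsum N₀ le_rfl

/-- Linear rate for a nonneg antitone sequence contracting every second step. -/
theorem exists_geometric_bound {r : ℕ → ℝ} {C : ℝ} {N : ℕ} (hC : 0 < C) (hr : ∀ n, 0 ≤ r n)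
    (hanti : Antitone r) (h : ∀ n ≥ N, r (n + 2) ≤ C * (r n - r (n + 2))) :
    ∃ B ρ : ℝ, 0 < B ∧ 0 < ρ ∧ ρ < 1 ∧ ∀ n, r n ≤ B * ρ ^ n := by
  -- The hypothesis reads `r (n + 2) ≤ q r n`, hence ratio `√q` per step. The constant chosen below
  -- covers the indices before `N + 2` by monotonicity; its `+ 1` keeps it positive.
  set q : ℝ := C / (1 + C) with hq
  have hq0 : 0 < q := by positivity
  have hq1 : q < 1 := by rw [hq, div_lt_one (by positivity)]; linarith
  have hρ0 : 0 < √q := Real.sqrt_pos.2 hq0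
  have hρ1 : √q < 1 := by rw [Real.sqrt_lt' one_pos]; simpa using hq1
  refine ⟨(r 0 + 1) / √q ^ (N + 1), √q, by have := hr 0; positivity, hρ0, hρ1, ?_⟩
  intro n
  induction n using Nat.strong_induction_on with
  | _ n ih =>
    by_cases hn : n < N + 2
    · have h1 : √q ^ (N + 1) ≤ √q ^ n := pow_le_pow_of_le_one hρ0.le hρ1.le (by omega)
      have h2 : r n ≤ r 0 := hanti (Nat.zero_le _)
      rw [div_mul_eq_mul_div, le_div_iff₀ (by positivity)]
      exact mul_le_mul (by linarith) h1 (by positivity) (by linarith [hr 0])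
    · obtain ⟨k, rfl⟩ : ∃ k, n = k + 2 := ⟨n - 2, by omega⟩
      have h1 := h k (by omega)
      have h2 := ih k (by omega)
      have h3 : r (k + 2) ≤ q * r k := by
        rw [hq, div_mul_eq_mul_div, le_div_iff₀ (by positivity)]
        linarith
      calc r (k + 2) ≤ q * r k := h3
        _ ≤ q * ((r 0 + 1) / √q ^ (N + 1) * √q ^ k) := mul_le_mul_of_nonneg_left h2 hq0.le
        _ = (r 0 + 1) / √q ^ (N + 1) * √q ^ (k + 2) := by
          rw [pow_add √q k 2, Real.sq_sqrt hq0.le]; ring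

/-- Sublinear rate for a nonneg antitone sequence with a superlinear two step recursion. -/
theorem exists_rpow_bound {r : ℕ → ℝ} {C θ : ℝ} {N : ℕ} (hC : 0 < C) (hθ1 : 1 < θ) (hθ2 : θ ≤ 2)
    (hr : ∀ n, 0 ≤ r n) (hanti : Antitone r)
    (h : ∀ n ≥ N, r (n + 2) ^ θ ≤ C * (r n - r (n + 2))) :
    ∃ B : ℝ, 0 < B ∧ ∀ n : ℕ, r n ≤ B * ((n : ℝ) + 1) ^ (-(1 / (θ - 1))) := by
  set p : ℝ := 1 / (θ - 1) with hp
  have hθ0 : 0 < θ - 1 := by linarith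
  have hp1 : 1 ≤ p := by rw [hp, le_div_iff₀ hθ0]; linarith
  -- `M ≥ 4p` makes `p / t ≤ 1/4` for `t = k + 3` with `k ≥ M`. In `B`, the first entry covers the
  -- indices below `M + 2`, the second ensures `B^(θ-1) ≥ 4pC`.
  obtain ⟨M, hM⟩ := exists_nat_ge (max (N : ℝ) (4 * p))
  have hMN : N ≤ M := by exact_mod_cast (le_max_left _ _).trans hM
  have hMp : 4 * p ≤ M := (le_max_right _ _).trans hM
  set B : ℝ := max ((r 0 + 1) * ((M : ℝ) + 2) ^ p) ((4 * p * C) ^ p) with hB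
  have hB0 : 0 < B := lt_of_lt_of_le (by have := hr 0; positivity) (le_max_left _ _)
  have hBX : 4 * p * C ≤ B ^ (θ - 1) := by
    have h1 : ((4 * p * C) ^ p) ^ (θ - 1) = 4 * p * C := by
      rw [← Real.rpow_mul (by positivity), hp, one_div_mul_cancel hθ0.ne', Real.rpow_one]
    rw [← h1]
    exact Real.rpow_le_rpow (by positivity) (le_max_right _ _) hθ0.le
  refine ⟨B, hB0, ?_⟩
  intro n
  induction n using Nat.strong_induction_on with
  | _ n ih =>
    by_cases hn : n < M + 2
    · have h1 : r n ≤ r 0 := hanti (Nat.zero_le _)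
      have hn' : (n : ℝ) + 1 ≤ M + 2 := by
        have : n + 1 ≤ M + 2 := by omega
        exact_mod_cast this
      have h2 : ((n : ℝ) + 1) ^ p ≤ ((M : ℝ) + 2) ^ p :=
        Real.rpow_le_rpow (by positivity) hn' (by linarith)
      rw [Real.rpow_neg (by positivity), ← div_eq_mul_inv, le_div_iff₀ (by positivity)]
      calc r n * ((n : ℝ) + 1) ^ p ≤ (r 0 + 1) * ((M : ℝ) + 2) ^ p :=
            mul_le_mul (by linarith) h2 (by positivity) (by linarith [hr 0])
        _ ≤ B := le_max_left _ _
    · obtain ⟨k, rfl⟩ : ∃ k, n = k + 2 := ⟨n - 2, by omega⟩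
      have h1 := h k (by omega)
      have h2 := ih k (by omega)
      have hkM : (M : ℝ) ≤ k := by
        have : M ≤ k := by omega
        exact_mod_cast this
      -- If `r (k + 2)` exceeded `b = B t^(-p)`, then `b^θ = b B^(θ-1) / t`, as `p (θ - 1) = 1`, and
      -- the recursion would force `r k > b (1 + 4p/t)`. But Bernoulli (`p ≥ 1`, from `θ ≤ 2`) and
      -- the induction hypothesis give `r k ≤ b (1 + 4p/t)`.
      by_contra hcon
      push Not at hcon
      set t : ℝ := (k : ℝ) + 3 with ht
      have ht0 : 0 < t := by positivity
      have e1 : ((k + 2 : ℕ) : ℝ) + 1 = t := by push_cast; ring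
      rw [e1] at hcon
      set b : ℝ := B * t ^ (-p) with hb
      have hb0 : 0 < b := by positivity
      -- lower bound on `r k`
      have h3 : b ^ θ ≤ r (k + 2) ^ θ := Real.rpow_le_rpow hb0.le hcon.le (by linarith)
      have h4 : b ^ θ = b * (B ^ (θ - 1) / t) := by
        have : b ^ θ = b * b ^ (θ - 1) := by
          rw [← Real.rpow_one_add' hb0.le (by linarith)]; congr 1; ring
        rw [this, hb, Real.mul_rpow hB0.le (by positivity), ← Real.rpow_mul ht0.le]
        have : -p * (θ - 1) = -1 := by rw [hp]; field_simp
        rw [this, Real.rpow_neg_one]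
        ring
      have h5 : b * (1 + 4 * p / t) < r k := by
        have h6 : b * (4 * p / t) * C ≤ C * (r k - r (k + 2)) := by
          calc b * (4 * p / t) * C = b * (4 * p * C / t) := by ring
            _ ≤ b * (B ^ (θ - 1) / t) := by gcongr
            _ ≤ _ := by rw [← h4]; exact h3.trans h1
        have h7 : b * (4 * p / t) ≤ r k - r (k + 2) := by
          refine le_of_mul_le_mul_left ?_ hC
          linarith
        linarith
      -- upper bound on `r k` from the induction hypothesis
      have hp4 : 4 * p ≤ t := by linarith
      have hbern : 1 - 2 * p / t ≤ (((k : ℝ) + 1) / t) ^ p := by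
        have h8 : -1 ≤ -(2 / t) := by
          have : 2 / t ≤ 1 := by rw [div_le_one ht0]; linarith
          linarith
        have h9 := one_add_mul_self_le_rpow_one_add h8 hp1
        have e2 : 1 + -(2 / t) = ((k : ℝ) + 1) / t := by
          field_simp
          rw [ht]; ring
        rw [e2] at h9
        calc 1 - 2 * p / t = 1 + p * -(2 / t) := by ring
          _ ≤ _ := h9
      have hprod : 1 ≤ (1 + 4 * p / t) * (1 - 2 * p / t) := by
        have hy : p / t ≤ 1 / 4 := by rw [div_le_iff₀ ht0]; linarith
        have hy0 : 0 ≤ p / t := by positivity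
        have e3 : (1 + 4 * p / t) * (1 - 2 * p / t) = 1 + 2 * (p / t) * (1 - 4 * (p / t)) := by ring
        rw [e3]
        nlinarith
      have h10 : ((k : ℝ) + 1) ^ (-p) ≤ t ^ (-p) * (1 + 4 * p / t) := by
        have hk0 : (0 : ℝ) < (k : ℝ) + 1 := by positivity
        rw [Real.rpow_neg hk0.le, Real.rpow_neg ht0.le, inv_mul_eq_div, inv_eq_one_div,
          div_le_div_iff₀ (by positivity) (by positivity)]
        rw [Real.div_rpow hk0.le ht0.le] at hbern
        have h11 : 1 ≤ (1 + 4 * p / t) * (((k : ℝ) + 1) ^ p / t ^ p) :=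
          hprod.trans (mul_le_mul_of_nonneg_left hbern (by positivity))
        rw [mul_div_assoc', le_div_iff₀ (by positivity)] at h11
        exact h11
      have h12 : r k ≤ b * (1 + 4 * p / t) := by
        calc r k ≤ B * ((k : ℝ) + 1) ^ (-p) := h2
          _ ≤ B * (t ^ (-p) * (1 + 4 * p / t)) := mul_le_mul_of_nonneg_left h10 hB0.le
          _ = _ := by rw [hb]; ring
      linarith

end Sequences

/-! ### Sufficient decrease of the merit function. -/

theorem add_coe_sub_le_of_sub_coe_le_sub_coe {a b : EReal} {p q : ℝ}
    (h : a - (p : EReal) ≤ b - (q : EReal)) : a + ((q - p : ℝ) : EReal) ≤ b := by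
  induction a with
  | bot => simp
  | top =>
    induction b with
    | bot => simp at h
    | top => simp
    | coe b =>
      rw [EReal.top_sub_coe, ← EReal.coe_sub, top_le_iff] at h
      exact absurd h (EReal.coe_ne_top _)
  | coe a =>
    induction b with
    | bot =>
      rw [EReal.bot_sub, ← EReal.coe_sub, le_bot_iff] at h
      exact absurd h (EReal.coe_ne_bot _)
    | top => simp
    | coe b => norm_cast at h ⊢; linarith

/-- The change of the proximal penalty from the old block `x` to a candidate `y`: the square of the
shift cancels, leaving a quadratic, an inertial cross term and the slope `w` of the ratio minorant.
-/
theorem mul_norm_sub_sq_sub {E : Type*} [NormedAddCommGroup E] [InnerProductSpace ℝ E] {t s : ℝ}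
    (ht : t ≠ 0) (y x e w : E) :
    t * ‖y - (x + s • e) - (1 / (2 * t)) • w‖ ^ 2 - t * ‖x - (x + s • e) - (1 / (2 * t)) • w‖ ^ 2
      = t * ‖y - x‖ ^ 2 - 2 * (t * s) * ⟪y - x, e⟫_ℝ - ⟪w, y - x⟫_ℝ := by
  have e1 : y - (x + s • e) - (1 / (2 * t)) • w = (y - x) - (s • e + (1 / (2 * t)) • w) := by abel
  have e2 : x - (x + s • e) - (1 / (2 * t)) • w = -(s • e + (1 / (2 * t)) • w) := by abel
  rw [e1, e2, norm_neg, norm_sub_sq_real, inner_add_right, inner_smul_right, inner_smul_right,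
    real_inner_comm w]
  field_simp
  ring

section Problem

variable {m : ℕ} {H : Fin m → Type*} [∀ i, NormedAddCommGroup (H i)]
  [∀ i, InnerProductSpace ℝ (H i)]

/-- The point whose first `k` blocks are those of `x'`, the others those of `x`. -/
def chainPoint (x x' : PiLp 2 H) (k : ℕ) : PiLp 2 H :=
  WithLp.toLp 2 fun j => if (j : ℕ) < k then x' j else x j

/-- Together with `blockPoint_new`: the `i`-th block update moves from chain point `i` to chain
point `i + 1`, so the gains of the blocks chain up. -/
theorem blockPoint_old (x x' : PiLp 2 H) (i : Fin m) :
    blockPoint x x' i (x i) = chainPoint x x' i := by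
  ext j
  rcases eq_or_ne j i with rfl | hj
  · simp [blockPoint, chainPoint]
  · simp [blockPoint, chainPoint, hj]

theorem blockPoint_new (x x' : PiLp 2 H) (i : Fin m) :
    blockPoint x x' i (x' i) = chainPoint x x' (i + 1) := by
  ext j
  rcases eq_or_ne j i with rfl | hj
  · simp [blockPoint, chainPoint]
  · simp [blockPoint, chainPoint, hj, hj.le_iff_lt]

/-- The gains are accumulated additively along the chain, never by subtracting values of `h`, which
may be `-∞`. -/
theorem add_sum_le_of_block_steps {h : PiLp 2 H → EReal} {x x' : PiLp 2 H} {q : Fin m → ℝ}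
    (hq : ∀ i, h (blockPoint x x' i (x i)) + (q i : EReal) ≤ h (blockPoint x x' i (x' i))) :
    h x + ((∑ i, q i : ℝ) : EReal) ≤ h x' := by
  have key : ∀ k ≤ m, h x + ((∑ j ∈ Finset.range k, (if hj : j < m then q ⟨j, hj⟩ else 0) : ℝ) :
      EReal)
      ≤ h (chainPoint x x' k) := by
    intro k
    induction k with
    | zero =>
      intro _
      have : chainPoint x x' 0 = x := by ext j; simp [chainPoint]
      simp [this]
    | succ k ih =>
      intro hk
      have hk' : k < m := by omega
      rw [Finset.sum_range_succ, EReal.coe_add, ← add_assoc]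
      refine (add_le_add_left (ih hk'.le) _).trans ?_
      have := hq ⟨k, hk'⟩
      rw [blockPoint_old, blockPoint_new] at this
      simpa [hk'] using this
  have h1 := key m le_rfl
  have h2 : chainPoint x x' m = x' := by ext j; simp [chainPoint]
  rw [h2, Finset.sum_range] at h1
  simpa using h1

variable {S : ∀ i, Set (H i)} {h : PiLp 2 H → EReal} {f g : ∀ i, H i → ℝ} {a b : Fin m → ℝ}

/-- The quadratic minorant of the ratio `f i / g i` on `S i`. -/
theorem StandingAssumption.ratio_minorant (hs : StandingAssumption S h f g a b) {x : PiLp 2 H}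
    {i : Fin m} (hx : x i ∈ S i) {z : H i} (hz : z ∈ S i) {u v : H i}
    (hu : u ∈ limitingSubdiff (fun y => (f i y : EReal)) (x i))
    (hv : v ∈ limitingSubdiff (fun y => (g i y : EReal)) (x i)) :
    f i (x i) / g i (x i) + ⟪direction f g x i u v, z - x i⟫_ℝ
      - 1 / 2 * (2 * ratioRoot f g x i * a i + ratioRoot f g x i ^ 2 * b i) * ‖z - x i‖ ^ 2
      ≤ f i z / g i z := by
  have hgx := hs.pos_g i _ hx
  have hgz := hs.pos_g i _ hz
  obtain ⟨O, -, hSO, hO⟩ := hs.nonneg_f i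
  have hfx := hO _ (hSO hx)
  have hfz := hO _ (hSO hz)
  by_cases hpos : 0 < f i (x i)
  · have h1 := hs.sqrt_f i _ hx z hz hpos u hu
    have h2 := hs.upper_g i _ hx z hz v hv
    have hsx : 0 < √(f i (x i)) := Real.sqrt_pos.2 hpos
    set y := ratioRoot f g x i with hy
    have hy0 : 0 ≤ y := by rw [hy, ratioRoot]; positivity
    have hyg : y * g i (x i) = √(f i (x i)) := by rw [hy, ratioRoot]; field_simp
    -- The minorant `2 y √f - y² g` touches the ratio at `x i` (`h3`) and lies below it elsewhere
    -- (`h4`), since the difference is `(√f - y g)² / g`.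
    have h3 : f i (x i) / g i (x i) = 2 * y * √(f i (x i)) - y ^ 2 * g i (x i) := by
      rw [div_eq_iff hgx.ne']
      nth_rewrite 1 [← Real.sq_sqrt hfx]
      rw [← hyg]
      ring
    have h4 : 2 * y * √(f i z) - y ^ 2 * g i z ≤ f i z / g i z := by
      rw [le_div_iff₀ hgz]
      have := Real.sq_sqrt hfz
      nlinarith [sq_nonneg (√(f i z) - y * g i z)]
    have h5 : ⟪direction f g x i u v, z - x i⟫_ℝ =
        2 * y * ⟪(2 * √(f i (x i)))⁻¹ • u, z - x i⟫_ℝ - y ^ 2 * ⟪v, z - x i⟫_ℝ := by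
      rw [direction, if_pos hpos, inner_sub_left, real_inner_smul_left, real_inner_smul_left,
        real_inner_smul_left, ← hy]
      field_simp
    rw [h3, h5]
    have h6 := mul_le_mul_of_nonneg_left h1 (by positivity : 0 ≤ 2 * y)
    have h7 := mul_le_mul_of_nonneg_left h2 (by positivity : 0 ≤ y ^ 2)
    nlinarith
  · have h0 : f i (x i) = 0 := le_antisymm (not_lt.1 hpos) hfx
    simp [direction, ratioRoot, h0]
    positivity

/-- Under smoothness the direction is the gradient of the ratio. -/
theorem StandingAssumption.direction_eq_gradient [∀ i, CompleteSpace (H i)]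
    (hs : StandingAssumption S h f g a b)
    (hf : ∀ i, ∃ O : Set (H i), IsOpen O ∧ S i ⊆ O ∧ ContDiffOn ℝ 1 (f i) O)
    (hg : ∀ i, ∃ O : Set (H i), IsOpen O ∧ S i ⊆ O ∧ ContDiffOn ℝ 1 (g i) O)
    {x : PiLp 2 H} {i : Fin m} (hx : x i ∈ S i) {u v : H i}
    (hu : u ∈ limitingSubdiff (fun y => (f i y : EReal)) (x i))
    (hv : v ∈ limitingSubdiff (fun y => (g i y : EReal)) (x i)) :
    direction f g x i u v = gradient (fun y => f i y / g i y) (x i) := by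
  have hgx := hs.pos_g i _ hx
  obtain ⟨Of, hOf, hSf, hf⟩ := hf i
  obtain ⟨Og, hOg, hSg, hg⟩ := hg i
  obtain ⟨O, hOo, hSO, hO⟩ := hs.nonneg_f i
  have hfd := (hf.differentiableOn one_ne_zero).differentiableAt (hOf.mem_nhds (hSf hx))
  have hgd := (hg.differentiableOn one_ne_zero).differentiableAt (hOg.mem_nhds (hSg hx))
  rw [gradient_div hfd hgd hgx.ne', eq_gradient_of_mem_limitingSubdiff hOf hf (hSf hx) hu,
    eq_gradient_of_mem_limitingSubdiff hOg hg (hSg hx) hv]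
  by_cases hpos : 0 < f i (x i)
  · have hsx : 0 < √(f i (x i)) := Real.sqrt_pos.2 hpos
    rw [direction, if_pos hpos, ratioRoot, div_pow, Real.sq_sqrt hpos.le]
    congr 2
    field_simp
  · have h0 : f i (x i) = 0 := le_antisymm (not_lt.1 hpos) (hO _ (hSO hx))
    -- Nonnegativity on a whole neighbourhood makes a zero of `f i` a local minimum. Its gradient
    -- vanishes there, which matches the value `0` in the definition of `direction`.
    have hmin : IsLocalMin (f i) (x i) := by
      filter_upwards [hOo.mem_nhds (hSO hx)] with z hz
      rw [h0]
      exact hO z hz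
    simp [direction, h0, gradient, hmin.fderiv_eq_zero]

theorem StandingAssumption.ne_top (hs : StandingAssumption S h f g a b) (x : PiLp 2 H) :
    h x ≠ ⊤ := fun ht => hs.proper.1 x (by simp [ht])

section Generated

variable {δ νbar : ℝ} {τ ν : ℕ → ℝ} {x : ℕ → PiLp 2 H}

theorem IsGenerated.mem (hx : IsGenerated S h f g a b δ νbar τ ν x) (n : ℕ) :
    x n ∈ feasible S := by
  cases n with
  | zero => exact hx.init_mem
  | succ n => exact hx.step_mem n

theorem IsGenerated.ratioRoot_nonneg (hs : StandingAssumption S h f g a b)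
    (hx : IsGenerated S h f g a b δ νbar τ ν x) (n : ℕ) (i : Fin m) :
    0 ≤ ratioRoot f g (x n) i :=
  div_nonneg (Real.sqrt_nonneg _) (hs.pos_g i _ (hx.mem n i)).le

theorem IsGenerated.le_stepsize (hm : 1 ≤ m) (hs : StandingAssumption S h f g a b)
    (hx : IsGenerated S h f g a b δ νbar τ ν x) (n : ℕ) : δ ≤ τ n := by
  let i : Fin m := ⟨0, hm⟩
  have h1 := hx.τ_ge n i
  have h2 := hx.ratioRoot_nonneg hs n i
  have h3 := hs.a_nonneg i
  have h4 := hs.b_nonneg i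
  have : 0 ≤ 1 / 2 * (2 * ratioRoot f g (x n) i * a i + ratioRoot f g (x n) i ^ 2 * b i) := by
    positivity
  linarith

theorem IsGenerated.stepsize_mul_inertia_le (hm : 1 ≤ m) (hs : StandingAssumption S h f g a b)
    (hx : IsGenerated S h f g a b δ νbar τ ν x) (n : ℕ) : τ n * ν n ≤ νbar := by
  have h1 : 0 < τ n := hx.δ_pos.trans_le (hx.le_stepsize hm hs n)
  have := hx.ν_le n
  rw [le_div_iff₀ h1] at this
  linarith

/-- The real value of the objective at `z`, provided `h z` is finite. -/
def realObjective (h : PiLp 2 H → EReal) (f g : ∀ i, H i → ℝ) (z : PiLp 2 H) : ℝ :=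
  (h z).toReal + ∑ i, f i (z i) / g i (z i)

theorem objective_eq_coe {z : PiLp 2 H} (hb : h z ≠ ⊥) (ht : h z ≠ ⊤) :
    objective h f g z = (realObjective h f g z : EReal) := by
  rw [objective, realObjective, EReal.coe_add, EReal.coe_toReal ht hb]

/-- The curvature of the ratio minorant is absorbed by `τ n` up to a remaining `δ`, and the inertial
cross term is split by `2⟪p, q⟫ ≤ ‖p‖² + ‖q‖²` with weight `τ n * ν n ≤ νbar`. The estimate stays in
`EReal` because finiteness of `h (x (n + 1))` is deduced from it. -/
theorem IsGenerated.step_gain (hm : 1 ≤ m) (hs : StandingAssumption S h f g a b)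
    (hx : IsGenerated S h f g a b δ νbar τ ν x) (n : ℕ) :
    h (x n) + ((∑ i, f i (x n i) / g i (x n i) - ∑ i, f i (x (n + 1) i) / g i (x (n + 1) i)
      + δ * ‖x (n + 1) - x n‖ ^ 2
      - νbar * (‖x (n + 1) - x n‖ ^ 2 + ‖x n - x (n - 1)‖ ^ 2) : ℝ) : EReal) ≤ h (x (n + 1)) := by
  have hτ : 0 < τ n := hx.δ_pos.trans_le (hx.le_stepsize hm hs n)
  have hτν := hx.stepsize_mul_inertia_le hm hs n
  have hτν0 : 0 ≤ τ n * ν n := mul_nonneg hτ.le (hx.ν_nonneg n)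
  choose u hu v hv hmax using hx.step n
  refine le_trans (add_le_add_right (EReal.coe_le_coe_iff.2 ?_) _)
    (add_sum_le_of_block_steps (x := x n) (x' := x (n + 1)) fun i =>
      add_coe_sub_le_of_sub_coe_le_sub_coe (hmax i (hx.mem n i)))
  simp only [PiLp.norm_sq_eq_of_L2, Finset.mul_sum, mul_add, ← Finset.sum_add_distrib,
    ← Finset.sum_sub_distrib]
  refine Finset.sum_le_sum fun i _ => ?_
  rw [mul_norm_sub_sq_sub hτ.ne']
  have h1 := hs.ratio_minorant (hx.mem n i) (hx.mem (n + 1) i) (hu i) (hv i)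
  have h2 := hx.τ_ge n i
  have h3 : 2 * ⟪x (n + 1) i - x n i, x n i - x (n - 1) i⟫_ℝ ≤
      ‖x (n + 1) i - x n i‖ ^ 2 + ‖x n i - x (n - 1) i‖ ^ 2 := by
    have := norm_sub_sq_real (x (n + 1) i - x n i) (x n i - x (n - 1) i)
    nlinarith [sq_nonneg ‖x (n + 1) i - x n i - (x n i - x (n - 1) i)‖]
  have h4 : 2 * (τ n * ν n) * ⟪x (n + 1) i - x n i, x n i - x (n - 1) i⟫_ℝ ≤
      νbar * (‖x (n + 1) i - x n i‖ ^ 2 + ‖x n i - x (n - 1) i‖ ^ 2) := by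
    calc _ = (τ n * ν n) * (2 * ⟪x (n + 1) i - x n i, x n i - x (n - 1) i⟫_ℝ) := by ring
      _ ≤ (τ n * ν n) * (‖x (n + 1) i - x n i‖ ^ 2 + ‖x n i - x (n - 1) i‖ ^ 2) :=
        mul_le_mul_of_nonneg_left h3 hτν0
      _ ≤ _ := mul_le_mul_of_nonneg_right hτν (by positivity)
  have h5 := mul_le_mul_of_nonneg_right h2 (sq_nonneg ‖x (n + 1) i - x n i‖)
  simp only [PiLp.sub_apply]
  linarith

theorem IsGenerated.ne_bot (hm : 1 ≤ m) (hs : StandingAssumption S h f g a b)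
    (hx : IsGenerated S h f g a b δ νbar τ ν x) (h0 : h (x 0) ≠ ⊥) (n : ℕ) : h (x n) ≠ ⊥ := by
  induction n with
  | zero => exact h0
  | succ n ih =>
    have := hx.step_gain hm hs n
    intro hb
    rw [hb, le_bot_iff, EReal.add_eq_bot_iff] at this
    rcases this with h1 | h1
    · exact ih h1
    · exact EReal.coe_ne_bot _ h1

/-- Sufficient decrease of the merit function along the iterates. -/
theorem IsGenerated.descent (hm : 1 ≤ m) (hs : StandingAssumption S h f g a b)
    (hx : IsGenerated S h f g a b δ νbar τ ν x) (h0 : h (x 0) ≠ ⊥) (n : ℕ) :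
    (δ - 2 * νbar) * ‖x (n + 1) - x n‖ ^ 2 ≤
      (-realObjective h f g (x n) + νbar * ‖x n - x (n - 1)‖ ^ 2)
        - (-realObjective h f g (x (n + 1)) + νbar * ‖x (n + 1) - x n‖ ^ 2) := by
  have h1 := hx.step_gain hm hs n
  rw [← EReal.coe_toReal (hs.ne_top (x n)) (hx.ne_bot hm hs h0 n),
    ← EReal.coe_toReal (hs.ne_top (x (n + 1))) (hx.ne_bot hm hs h0 (n + 1)),
    ← EReal.coe_add, EReal.coe_le_coe_iff] at h1
  simp only [realObjective]
  linarith

end Generated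

end Problem

/-! ### Block geometry, and subgradients of `-F + δ_S` and of the merit function. -/

section Problem

variable {m : ℕ} {H : Fin m → Type*} [∀ i, NormedAddCommGroup (H i)]
  [∀ i, InnerProductSpace ℝ (H i)]

theorem norm_le_card_mul {y : PiLp 2 H} {B : ℝ} (hB : 0 ≤ B) (hy : ∀ i, ‖y i‖ ≤ B) :
    ‖y‖ ≤ m * B := by
  refine (abs_le_of_sq_le_sq' ?_ (by positivity)).2
  rw [PiLp.norm_sq_eq_of_L2]
  calc ∑ i, ‖y i‖ ^ 2 ≤ ∑ _i : Fin m, B ^ 2 :=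
        Finset.sum_le_sum fun i _ => pow_le_pow_left₀ (norm_nonneg _) (hy i) 2
    _ = m * B ^ 2 := by simp
    _ ≤ (m * m : ℕ) * B ^ 2 := by
        gcongr
        exact Nat.le_mul_self m
    _ = _ := by push_cast; ring

theorem blockPoint_sub_blockPoint (x x' : PiLp 2 H) (i : Fin m) (ξ η : H i) :
    blockPoint x x' i ξ - blockPoint x x' i η = PiLp.single 2 i (ξ - η) := by
  ext j
  rcases eq_or_ne j i with rfl | hj
  · simp [blockPoint]
  · simp [blockPoint, hj]

theorem continuous_blockPoint (x x' : PiLp 2 H) (i : Fin m) :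
    Continuous (blockPoint x x' i) := by
  refine (Isometry.of_dist_eq fun ξ η => ?_).continuous
  rw [dist_eq_norm, blockPoint_sub_blockPoint, PiLp.norm_single, dist_eq_norm]

theorem inner_single (p : PiLp 2 H) (i : Fin m) (v : H i) :
    ⟪p, PiLp.single 2 i v⟫_ℝ = ⟪p i, v⟫_ℝ := by
  rw [PiLp.inner_apply, Finset.sum_eq_single i]
  · simp
  · intro j _ hj
    simp [hj]
  · simp

theorem blockPoint_mem_feasible {S : ∀ i, Set (H i)} {x x' : PiLp 2 H} (hx : x ∈ feasible S)
    (hx' : x' ∈ feasible S) {i : Fin m} {ξ : H i} (hξ : ξ ∈ S i) :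
    blockPoint x x' i ξ ∈ feasible S := by
  intro j
  rcases eq_or_ne j i with rfl | hj
  · simpa [blockPoint] using hξ
  · by_cases hji : j < i
    · simpa [blockPoint, hj, hji] using hx' j
    · simpa [blockPoint, hj, hji] using hx j

/-- The two points differ only in blocks after `i`, which still hold the old values. This bounds the
error of evaluating `∇h` before the sweep is finished. -/
theorem norm_blockPoint_sub_le (x x' : PiLp 2 H) (i : Fin m) :
    ‖blockPoint x x' i (x' i) - x'‖ ≤ ‖x' - x‖ := by
  refine (abs_le_of_sq_le_sq' ?_ (norm_nonneg _)).2
  rw [PiLp.norm_sq_eq_of_L2, PiLp.norm_sq_eq_of_L2]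
  refine Finset.sum_le_sum fun j _ => ?_
  refine pow_le_pow_left₀ (norm_nonneg _) ?_ 2
  rcases eq_or_ne j i with rfl | hj
  · simp [blockPoint]
  · by_cases hji : j < i
    · simp [blockPoint, hj, hji]
    · simp [blockPoint, hj, hji, norm_sub_rev (x' j)]

theorem mul_norm_sq_sub_mul_norm_sq {E : Type*} [NormedAddCommGroup E] [InnerProductSpace ℝ E]
    (t : ℝ) (z y c : E) :
    t * ‖z - c‖ ^ 2 - t * ‖y - c‖ ^ 2 =
      2 * t * ⟪y - c, z - y⟫_ℝ + t * ‖z - y‖ ^ 2 := by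
  have : z - c = (z - y) + (y - c) := by abel
  rw [this, norm_add_sq_real, real_inner_comm]
  ring

theorem isClosed_feasible {S : ∀ i, Set (H i)} (hS : ∀ i, IsClosed (S i)) :
    IsClosed (feasible S) := by
  have : feasible S = ⋂ i, (fun z : PiLp 2 H => z i) ⁻¹' S i := by
    ext z; simp [feasible]
  rw [this]
  exact isClosed_iInter fun i => (hS i).preimage (PiLp.continuous_apply 2 H i)

/-- A block-wise Fréchet normal vector to a product is a Fréchet subgradient of its indicator. -/
theorem mem_frechetSubdiff_indicatorFn {S : ∀ i, Set (H i)} {y p : PiLp 2 H}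
    (hy : y ∈ feasible S)
    (hp : ∀ i, ∀ ε : ℝ, 0 < ε → ∀ᶠ ξ in 𝓝 (y i), ξ ∈ S i →
      ⟪p i, ξ - y i⟫_ℝ ≤ ε * ‖ξ - y i‖) :
    p ∈ frechetSubdiff (indicatorFn (feasible S)) y := by
  have h0 : indicatorFn (feasible S) y = 0 := by simp [indicatorFn, hy]
  refine ⟨by simp [h0], by simp [h0], fun ε hε => ?_⟩
  -- With `ε / (m + 1)` per block the `m` errors add up to at most `ε`, and the denominator never
  -- vanishes.
  have hev : ∀ᶠ z in 𝓝 y, ∀ i, z i ∈ S i →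
      ⟪p i, z i - y i⟫_ℝ ≤ ε / (m + 1) * ‖z i - y i‖ := by
    rw [eventually_all]
    intro i
    exact ((PiLp.continuous_apply 2 H i).tendsto y).eventually (hp i _ (by positivity))
  filter_upwards [hev] with z hz
  by_cases hzS : z ∈ feasible S
  · have h1 : ⟪p, z - y⟫_ℝ ≤ ε * ‖z - y‖ := by
      rw [PiLp.inner_apply]
      calc ∑ i, ⟪p i, (z - y) i⟫_ℝ ≤ ∑ _i : Fin m, ε / (m + 1) * ‖z - y‖ := by
            refine Finset.sum_le_sum fun i _ => (hz i (hzS i)).trans ?_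
            exact mul_le_mul_of_nonneg_left (PiLp.norm_apply_le (z - y) i) (by positivity)
        _ = m / (m + 1) * (ε * ‖z - y‖) := by simp; ring
        _ ≤ 1 * (ε * ‖z - y‖) := by
            refine mul_le_mul_of_nonneg_right ?_ (by positivity)
            rw [div_le_one (by positivity)]
            linarith
        _ = _ := one_mul _
    have h2 : indicatorFn (feasible S) z = 0 := by simp [indicatorFn, hzS]
    rw [h0, h2, ← EReal.coe_zero, EReal.coe_le_coe_iff, EReal.toReal_coe]
    linarith
  · have h2 : indicatorFn (feasible S) z = ⊤ := by simp [indicatorFn, hzS]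
    rw [h2]
    exact le_top

variable {S : ∀ i, Set (H i)} {h : PiLp 2 H → EReal} {f g : ∀ i, H i → ℝ} {a b : Fin m → ℝ}

/-- Separates the nonsmooth part `-h + δ_S` from the differentiable ratios, in the form used by
`add_mem_frechetSubdiff`. -/
theorem negObjective_eq (z : PiLp 2 H) :
    negObjective S h f g z = (-h z + indicatorFn (feasible S) z)
      + ((-∑ i, f i (z i) / g i (z i) : ℝ) : EReal) := by
  rw [negObjective, objective, EReal.neg_add (Or.inr (EReal.coe_ne_top _))
    (Or.inr (EReal.coe_ne_bot _)), EReal.coe_neg, sub_eq_add_neg, add_right_comm]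

theorem negObjective_eq_coe (hs : StandingAssumption S h f g a b) {z : PiLp 2 H}
    (hz : z ∈ feasible S) (hb : h z ≠ ⊥) :
    negObjective S h f g z = ((-realObjective h f g z : ℝ) : EReal) := by
  rw [negObjective, objective_eq_coe hb (hs.ne_top z)]
  simp [indicatorFn, hz]

theorem merit_eq_coe (hs : StandingAssumption S h f g a b) {z y : PiLp 2 H} {νbar : ℝ}
    (hz : z ∈ feasible S) (hb : h z ≠ ⊥) :
    merit S h f g νbar (WithLp.toLp 2 (z, y)) =
      ((-realObjective h f g z + νbar * ‖z - y‖ ^ 2 : ℝ) : EReal) := by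
  rw [merit, EReal.coe_add, ← negObjective_eq_coe hs hz hb]
  rfl

/-- The Fréchet subgradients of the merit function built from those of `negObjective`. -/
theorem exists_mem_frechetSubdiff_merit {νbar : ℝ} (hν : 0 ≤ νbar) {y y' u : PiLp 2 H}
    (hu : u ∈ frechetSubdiff (negObjective S h f g) y) :
    ∃ U ∈ frechetSubdiff (merit S h f g νbar) (WithLp.toLp 2 (y, y')),
      ‖U‖ ≤ ‖u‖ + 4 * νbar * ‖y - y'‖ := by
  set P := WithLp.toLp 2 (y, y') with hP
  set fstL := WithLp.fstL 2 ℝ (PiLp 2 H) (PiLp 2 H)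
  set sndL := WithLp.sndL 2 ℝ (PiLp 2 H) (PiLp 2 H)
  have h1 : WithLp.toLp 2 (u, (0 : PiLp 2 H)) ∈
      frechetSubdiff (fun q : WithLp 2 (PiLp 2 H × PiLp 2 H) => negObjective S h f g q.fst) P := by
    refine ⟨hu.1, hu.2.1, fun ε hε => ?_⟩
    filter_upwards [(fstL.continuous.tendsto P).eventually (hu.2.2 ε hε)] with q hq
    refine le_trans (EReal.coe_le_coe_iff.2 ?_) hq
    have h2 : ‖(q - P).fst‖ ≤ ‖q - P‖ := WithLp.norm_fst_le _ _
    have h3 : ⟪WithLp.toLp 2 (u, (0 : PiLp 2 H)), q - P⟫_ℝ = ⟪u, q.fst - y⟫_ℝ := by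
      simp [WithLp.prod_inner_apply, hP]
    rw [h3]
    have h4 : ε * ‖q.fst - y‖ ≤ ε * ‖q - P‖ := mul_le_mul_of_nonneg_left h2 hε.le
    change (negObjective S h f g y).toReal + _ - _ ≤
      (negObjective S h f g y).toReal + ⟪u, q.fst - y⟫_ℝ - ε * ‖q.fst - y‖
    linarith
  have h2 : HasFDerivAt (fun q : WithLp 2 (PiLp 2 H × PiLp 2 H) => νbar * ‖q.fst - q.snd‖ ^ 2)
      (νbar • (2 • (innerSL ℝ (y - y')) ∘SL (fstL - sndL))) P :=
    (((fstL - sndL).hasFDerivAt (x := P)).norm_sq).const_mul νbar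
  -- The gradient of `νbar ‖y - y'‖²` in both variables is `(w, -w)`; each half has norm `2 νbar ‖y
  -- - y'‖`, whence the factor `4`.
  set w : PiLp 2 H := (2 * νbar) • (y - y') with hw
  refine ⟨_, add_mem_frechetSubdiff (p := WithLp.toLp 2 (w, (0 : PiLp 2 H)) +
    WithLp.toLp 2 ((0 : PiLp 2 H), -w)) h1 h2 ?_ (Eventually.of_forall fun q => rfl), ?_⟩
  · intro v
    simp [WithLp.prod_inner_apply, hw, real_inner_smul_left, inner_add_left,
      fstL, sndL, inner_sub_left]
    ring
  · refine (norm_add_le _ _).trans ?_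
    have h3 := norm_add_le (WithLp.toLp 2 (w, (0 : PiLp 2 H))) (WithLp.toLp 2 ((0 : PiLp 2 H), -w))
    rw [WithLp.norm_toLp_fst, WithLp.norm_toLp_snd, norm_neg, hw, norm_smul, Real.norm_eq_abs,
      abs_of_nonneg (by positivity)] at h3
    rw [WithLp.norm_toLp_fst]
    linarith

/-- The desingularization inequality at a point with a Fréchet subgradient. -/
theorem one_le_deriv_mul_norm {E : Type*} [NormedAddCommGroup E] [InnerProductSpace ℝ E]
    {Φ : E → EReal} {y u : E} {φ : ℝ → ℝ} {r : ℝ}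
    (hKL : 1 ≤ ENNReal.ofReal (deriv φ r) * Metric.infEDist 0 (limitingSubdiff Φ y))
    (hu : u ∈ frechetSubdiff Φ y) (hφ : 0 ≤ deriv φ r) :
    1 ≤ deriv φ r * ‖u‖ := by
  have h1 : Metric.infEDist 0 (limitingSubdiff Φ y) ≤ ENNReal.ofReal ‖u‖ := by
    refine (Metric.infEDist_le_edist_of_mem (frechetSubdiff_subset_limitingSubdiff _ _ hu)).trans ?_
    rw [edist_zero_left, ofReal_norm]
    exact le_rfl
  have h2 := hKL.trans (mul_le_mul_right h1 _)
  rw [← ENNReal.ofReal_mul hφ, ENNReal.one_le_ofReal] at h2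
  exact h2

variable [∀ i, CompleteSpace (H i)]

theorem exists_hasFDerivAt_neg_sum_ratio (hs : StandingAssumption S h f g a b)
    (hf : ∀ i, ∃ O : Set (H i), IsOpen O ∧ S i ⊆ O ∧ ContDiffOn ℝ 1 (f i) O)
    (hg : ∀ i, ∃ O : Set (H i), IsOpen O ∧ S i ⊆ O ∧ ContDiffOn ℝ 1 (g i) O)
    {z : PiLp 2 H} (hz : z ∈ feasible S) :
    ∃ L : PiLp 2 H →L[ℝ] ℝ,
      HasFDerivAt (fun z : PiLp 2 H => -∑ i, f i (z i) / g i (z i)) L z ∧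
      ∀ v, L v = ⟪(WithLp.toLp 2 fun i => -gradient (fun y => f i y / g i y) (z i) :
        PiLp 2 H), v⟫_ℝ := by
  have hd : ∀ i, HasFDerivAt (fun z : PiLp 2 H => f i (z i) / g i (z i))
      ((fderiv ℝ (fun y => f i y / g i y) (z i)) ∘L PiLp.proj 2 H i) z := by
    intro i
    obtain ⟨Of, hOf, hSf, hf⟩ := hf i
    obtain ⟨Og, hOg, hSg, hg⟩ := hg i
    have hfd := (hf.differentiableOn one_ne_zero).differentiableAt (hOf.mem_nhds (hSf (hz i)))
    have hgd := (hg.differentiableOn one_ne_zero).differentiableAt (hOg.mem_nhds (hSg (hz i)))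
    have h1 := (hasFDerivAt_div hfd.hasFDerivAt hgd.hasFDerivAt
      (hs.pos_g i _ (hz i)).ne').differentiableAt.hasFDerivAt
    exact HasFDerivAt.comp (g := fun y => f i y / g i y) z h1
      (PiLp.proj (𝕜 := ℝ) 2 H i).hasFDerivAt
  refine ⟨_, (HasFDerivAt.fun_sum fun i _ => hd i).neg, fun v => ?_⟩
  simp [PiLp.inner_apply]

theorem continuousAt_gradient_ratio (hs : StandingAssumption S h f g a b)
    (hf : ∀ i, ∃ O : Set (H i), IsOpen O ∧ S i ⊆ O ∧ ContDiffOn ℝ 1 (f i) O)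
    (hg : ∀ i, ∃ O : Set (H i), IsOpen O ∧ S i ⊆ O ∧ ContDiffOn ℝ 1 (g i) O)
    {i : Fin m} {z : H i} (hz : z ∈ S i) :
    ContinuousAt (gradient (fun y => f i y / g i y)) z := by
  obtain ⟨Of, hOf, hSf, hf⟩ := hf i
  obtain ⟨Og, hOg, hSg, hg⟩ := hg i
  -- `g i` is positive only on `S i`; continuity extends this to an open neighbourhood, where the
  -- ratio is continuously differentiable.
  set O := (Of ∩ Og) ∩ g i ⁻¹' Set.Ioi 0 with hO
  have hOo : IsOpen O :=
    (hg.continuousOn.mono Set.inter_subset_right).isOpen_inter_preimage (hOf.inter hOg) isOpen_Ioi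
  have hzO : z ∈ O := ⟨⟨hSf hz, hSg hz⟩, hs.pos_g i _ hz⟩
  refine (continuousOn_gradient hOo ?_).continuousAt (hOo.mem_nhds hzO)
  exact (hf.mono fun y hy => hy.1.1).div (hg.mono fun y hy => hy.1.2) fun y hy => ne_of_gt hy.2

end Problem

/-! ### Optimality of a step: small subgradients and convergence of `h`. -/

section Generated

variable {m : ℕ} {H : Fin m → Type*} [∀ i, NormedAddCommGroup (H i)]
  [∀ i, InnerProductSpace ℝ (H i)] [∀ i, CompleteSpace (H i)]
  {S : ∀ i, Set (H i)} {h : PiLp 2 H → EReal} {f g : ∀ i, H i → ℝ} {a b : Fin m → ℝ}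
  {δ νbar : ℝ} {τ ν : ℕ → ℝ} {x : ℕ → PiLp 2 H}

/-- The proximal subgradient produced by the optimality of the `n`-th step. -/
def proxGrad (f g : ∀ i, H i → ℝ) (τ ν : ℕ → ℝ) (x : ℕ → PiLp 2 H) (n : ℕ) : PiLp 2 H :=
  WithLp.toLp 2 fun i =>
    (-(2 * τ n)) • (x (n + 1) i - x n i - ν n • (x n i - x (n - 1) i))
      + gradient (fun y => f i y / g i y) (x n i)

/-- The penalty is a square around a centre `c`, and `proxGrad` is `-2 τ (x_{n+1} - c)` blockwise.
Expanding the square around the maximizer instead of `c` makes the linear term exact. -/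
theorem IsGenerated.block_optimality (hm : 1 ≤ m) (hs : StandingAssumption S h f g a b)
    (hx : IsGenerated S h f g a b δ νbar τ ν x)
    (hf : ∀ i, ∃ O : Set (H i), IsOpen O ∧ S i ⊆ O ∧ ContDiffOn ℝ 1 (f i) O)
    (hg : ∀ i, ∃ O : Set (H i), IsOpen O ∧ S i ⊆ O ∧ ContDiffOn ℝ 1 (g i) O)
    (n : ℕ) (i : Fin m) {ξ : H i} (hξ : ξ ∈ S i) :
    h (blockPoint (x n) (x (n + 1)) i ξ) +
      ((⟪proxGrad f g τ ν x n i, ξ - x (n + 1) i⟫_ℝ - τ n * ‖ξ - x (n + 1) i‖ ^ 2 : ℝ) : EReal)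
      ≤ h (blockPoint (x n) (x (n + 1)) i (x (n + 1) i)) := by
  have hτ : 0 < τ n := hx.δ_pos.trans_le (hx.le_stepsize hm hs n)
  obtain ⟨u, hu, v, hv, hmax⟩ := hx.step n i
  have h1 := add_coe_sub_le_of_sub_coe_le_sub_coe (hmax hξ)
  rw [hs.direction_eq_gradient hf hg (hx.mem n i) hu hv] at h1
  convert h1 using 3
  set c := x n i + ν n • (x n i - x (n - 1) i) +
    (1 / (2 * τ n)) • gradient (fun y => f i y / g i y) (x n i) with hc
  rw [sub_sub _ (x n i + ν n • (x n i - x (n - 1) i)),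
    sub_sub _ (x n i + ν n • (x n i - x (n - 1) i)),
    ← hc]
  have h2 := mul_norm_sq_sub_mul_norm_sq (τ n) ξ (x (n + 1) i) c
  have h3 : proxGrad f g τ ν x n i = (-(2 * τ n)) • (x (n + 1) i - c) := by
    have : x (n + 1) i - c = (x (n + 1) i - x n i - ν n • (x n i - x (n - 1) i)) -
        (1 / (2 * τ n)) • gradient (fun y => f i y / g i y) (x n i) := by rw [hc]; abel
    rw [this, smul_sub _ _ ((1 / (2 * τ n)) • _), smul_smul]
    have : -(2 * τ n) * (1 / (2 * τ n)) = -1 := by field_simp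
    rw [this, neg_one_smul, sub_neg_eq_add]
    rfl
  rw [h3, real_inner_smul_left]
  linarith

/-- With a single block the optimality of the step is a proximal inequality for `-h + δ_S`. -/
theorem IsGenerated.single_block_optimality {H : Fin 1 → Type*} [∀ i, NormedAddCommGroup (H i)]
    [∀ i, InnerProductSpace ℝ (H i)] [∀ i, CompleteSpace (H i)]
    {S : ∀ i, Set (H i)} {h : PiLp 2 H → EReal} {f g : ∀ i, H i → ℝ} {a b : Fin 1 → ℝ}
    {x : ℕ → PiLp 2 H} (hs : StandingAssumption S h f g a b)
    (hx : IsGenerated S h f g a b δ νbar τ ν x)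
    (hf : ∀ i, ∃ O : Set (H i), IsOpen O ∧ S i ⊆ O ∧ ContDiffOn ℝ 1 (f i) O)
    (hg : ∀ i, ∃ O : Set (H i), IsOpen O ∧ S i ⊆ O ∧ ContDiffOn ℝ 1 (g i) O) (n : ℕ) {z : PiLp 2 H}
    (hz : z ∈ feasible S) :
    h z + ((⟪proxGrad f g τ ν x n, z - x (n + 1)⟫_ℝ - τ n * ‖z - x (n + 1)‖ ^ 2 : ℝ) : EReal)
      ≤ h (x (n + 1)) := by
  have h1 := hx.block_optimality le_rfl hs hf hg n 0 (hz 0)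
  have hbp : ∀ y : PiLp 2 H, blockPoint (x n) (x (n + 1)) 0 (y 0) = y := by
    intro y
    ext j
    fin_cases j
    simp [blockPoint]
  rw [hbp, hbp] at h1
  have h2 : ⟪proxGrad f g τ ν x n, z - x (n + 1)⟫_ℝ =
      ⟪proxGrad f g τ ν x n 0, z 0 - x (n + 1) 0⟫_ℝ := by
    simp [PiLp.inner_apply]
  have h3 : ‖z - x (n + 1)‖ ^ 2 = ‖z 0 - x (n + 1) 0‖ ^ 2 := by
    simp [PiLp.norm_sq_eq_of_L2]
  rw [h2, h3]
  exact h1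

/-- On `C` the hypothesis is a proximal inequality for `-h`; off `C` the function is `+∞`. This
needs `htop`, since `-∞ + ∞ = -∞` in `EReal`. -/
theorem mem_frechetSubdiff_neg_add_indicatorFn {E : Type*} [NormedAddCommGroup E]
    [InnerProductSpace ℝ E] {C : Set E} {h : E → EReal} {y p : E} {t : ℝ} (hy : y ∈ C)
    (hb : h y ≠ ⊥) (ht : h y ≠ ⊤)
    (H : ∀ z ∈ C, h z + ((⟪p, z - y⟫_ℝ - t * ‖z - y‖ ^ 2 : ℝ) : EReal) ≤ h y)
    (htop : ∀ z, h z ≠ ⊤) :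
    p ∈ frechetSubdiff (fun z => -h z + indicatorFn C z) y := by
  have hyv : -h y + indicatorFn C y = ((-(h y).toReal : ℝ) : EReal) := by
    rw [EReal.coe_neg, EReal.coe_toReal ht hb]
    simp [indicatorFn, hy]
  refine mem_frechetSubdiff_of_proximal (κ := t) (by rw [hyv]; exact EReal.coe_ne_bot _)
    (by rw [hyv]; exact EReal.coe_ne_top _) fun z => ?_
  rw [hyv, EReal.toReal_coe]
  by_cases hz : z ∈ C
  · have h1 := H z hz
    have h2 : indicatorFn C z = 0 := by simp [indicatorFn, hz]
    rw [h2, add_zero]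
    by_cases hzb : h z = ⊥
    · simp [hzb]
    · rw [← EReal.coe_toReal (htop z) hzb, ← EReal.coe_toReal ht hb, ← EReal.coe_add,
        EReal.coe_le_coe_iff] at h1
      rw [← EReal.coe_toReal (htop z) hzb, ← EReal.coe_neg, EReal.coe_le_coe_iff]
      linarith
  · have h2 : indicatorFn C z = ⊤ := by simp [indicatorFn, hz]
    have h3 : -h z ≠ ⊥ := by simpa using htop z
    rw [h2, EReal.add_top_of_ne_bot h3]
    exact le_top

/-- With a smooth coupling term the prox-gradient is, up to a small correction, a Fréchet
subgradient of `-h + δ_S`. -/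
theorem IsGenerated.exists_correction_of_smooth (hm : 1 ≤ m) (hs : StandingAssumption S h f g a b)
    (hx : IsGenerated S h f g a b δ νbar τ ν x)
    (hf : ∀ i, ∃ O : Set (H i), IsOpen O ∧ S i ⊆ O ∧ ContDiffOn ℝ 1 (f i) O)
    (hg : ∀ i, ∃ O : Set (H i), IsOpen O ∧ S i ⊆ O ∧ ContDiffOn ℝ 1 (g i) O)
    (hh : HasLipschitzGradientOn h (feasible S)) :
    ∃ K : ℝ, 0 ≤ K ∧ ∀ n, ∃ κ : PiLp 2 H, ‖κ‖ ≤ K * ‖x (n + 1) - x n‖ ∧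
      proxGrad f g τ ν x n + κ ∈
        frechetSubdiff (fun z => -h z + indicatorFn (feasible S) z) (x (n + 1)) := by
  obtain ⟨O, hr, hO, hSO, hhr, hdiff, K, hK⟩ := hh
  refine ⟨m * K, by positivity, fun n => ?_⟩
  set x' := x (n + 1) with hx'
  set bp : Fin m → PiLp 2 H := fun i => blockPoint (x n) x' i (x' i) with hbp
  have hbpS : ∀ i, bp i ∈ feasible S := fun i =>
    blockPoint_mem_feasible (hx.mem n) (hx.mem (n + 1)) (hx.mem (n + 1) i)
  have hfd : ∀ z ∈ O, HasFDerivAt hr (fderiv ℝ hr z) z := fun z hz =>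
    (hdiff.differentiableAt (hO.mem_nhds hz)).hasFDerivAt
  -- Block `i` is optimal at the intermediate point `bp i`, so `q` collects partial gradients of `h`
  -- at different points. Below, `proxGrad + q` is a Fréchet normal to the product; adding `-∇h
  -- (x')` leaves the correction `q - ∇h (x')`, bounded by the Lipschitz constant.
  set q : PiLp 2 H := WithLp.toLp 2 fun i => gradient hr (bp i) i with hq
  refine ⟨q - gradient hr x', ?_, ?_⟩
  · rw [mul_assoc]
    refine norm_le_card_mul (by positivity) fun i => ?_
    calc ‖(q - gradient hr x') i‖ = ‖(gradient hr (bp i) - gradient hr x') i‖ := rfl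
      _ ≤ ‖gradient hr (bp i) - gradient hr x'‖ := PiLp.norm_apply_le _ i
      _ ≤ K * ‖bp i - x'‖ := hK.norm_sub_le (hbpS i) (hx.mem (n + 1))
      _ ≤ K * ‖x' - x n‖ :=
        mul_le_mul_of_nonneg_left (norm_blockPoint_sub_le (x n) x' i) K.coe_nonneg
  · have hn : proxGrad f g τ ν x n + q ∈ frechetSubdiff (indicatorFn (feasible S)) x' := by
      refine mem_frechetSubdiff_indicatorFn (hx.mem (n + 1)) fun i ε hε => ?_
      have hcont : Tendsto (blockPoint (x n) x' i) (𝓝 (x' i)) (𝓝 (bp i)) :=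
        (continuous_blockPoint (x n) x' i).tendsto (x' i)
      have hlim : Tendsto (fun ξ => τ n * ‖ξ - x' i‖) (𝓝 (x' i)) (𝓝 0) := by
        have : Continuous fun ξ => τ n * ‖ξ - x' i‖ := by fun_prop
        simpa using this.tendsto (x' i)
      filter_upwards [hcont.eventually (eventually_abs_sub_le_of_hasFDerivAt
        (hfd (bp i) (hSO (hbpS i))) (half_pos hε)), hlim.eventually_lt_const (half_pos hε)]
        with ξ h1 h2 hξ
      have h3 := hx.block_optimality hm hs hf hg n i hξ
      have hξS : blockPoint (x n) x' i ξ ∈ feasible S :=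
        blockPoint_mem_feasible (hx.mem n) (hx.mem (n + 1)) hξ
      rw [← hx', hhr _ (hSO hξS), hhr _ (hSO (hbpS i)), ← EReal.coe_add, EReal.coe_le_coe_iff] at h3
      have hsub : blockPoint (x n) x' i ξ - bp i = PiLp.single 2 i (ξ - x' i) :=
        blockPoint_sub_blockPoint _ _ _ _ _
      rw [hsub, fderiv_apply_eq_inner_gradient, inner_single, PiLp.norm_single] at h1
      have h4 := (abs_le.1 h1).1
      have h5 : ⟪(proxGrad f g τ ν x n + q) i, ξ - x' i⟫_ℝ =
          ⟪proxGrad f g τ ν x n i, ξ - x' i⟫_ℝ + ⟪gradient hr (bp i) i, ξ - x' i⟫_ℝ := by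
        rw [PiLp.add_apply, inner_add_left]
      rw [h5]
      change hr (blockPoint (x n) x' i ξ) + _ ≤ hr (bp i) at h3
      nlinarith [norm_nonneg (ξ - x' i)]
    have hd := (hfd x' (hSO (hx.mem (n + 1)))).neg
    have := add_mem_frechetSubdiff (p := -gradient hr x')
      (Φ := fun z => -h z + indicatorFn (feasible S) z) hn hd
      (fun v => by simp) ?_
    · convert this using 1
      abel
    · filter_upwards [hO.mem_nhds (hSO (hx.mem (n + 1)))] with z hz
      rw [hhr z hz, add_comm]
      simp

/-- Existence of small Fréchet subgradients of `-F + δ_S` along the iterates. -/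
theorem IsGenerated.exists_small_subgradient (hm : 1 ≤ m) (hs : StandingAssumption S h f g a b)
    (hx : IsGenerated S h f g a b δ νbar τ ν x) (h0 : h (x 0) ≠ ⊥)
    (hf : ∀ i, ∃ O : Set (H i), IsOpen O ∧ S i ⊆ O ∧ ContDiffOn ℝ 1 (f i) O)
    (hg : ∀ i, ∃ O : Set (H i), IsOpen O ∧ S i ⊆ O ∧ ContDiffOn ℝ 1 (g i) O)
    {T : ℝ} (hτ : ∀ᶠ n in atTop, τ n ≤ T)
    (hh : m = 1 ∨ HasLipschitzGradientOn h (feasible S))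
    (hlip : ∃ ε l : ℝ, 0 < ε ∧ 0 < l ∧ ∀ i, ∀ z ∈ S i, ∀ z' ∈ S i, ‖z - z'‖ ≤ ε →
      ‖gradient (fun y => f i y / g i y) z - gradient (fun y => f i y / g i y) z'‖
        ≤ l * ‖z - z'‖)
    (hd : Tendsto (fun n => ‖x (n + 1) - x n‖) atTop (𝓝 0)) :
    ∃ C : ℝ, 0 < C ∧ ∀ᶠ n in atTop, ∃ u ∈ frechetSubdiff (negObjective S h f g) (x (n + 1)),
      ‖u‖ ≤ C * (‖x (n + 1) - x n‖ + ‖x n - x (n - 1)‖) := by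
  obtain ⟨K, hK0, hK⟩ : ∃ K : ℝ, 0 ≤ K ∧ ∀ n, ∃ κ : PiLp 2 H, ‖κ‖ ≤ K * ‖x (n + 1) - x n‖ ∧
      proxGrad f g τ ν x n + κ ∈
        frechetSubdiff (fun z => -h z + indicatorFn (feasible S) z) (x (n + 1)) := by
    rcases hh with rfl | hh
    · refine ⟨0, le_rfl, fun n => ⟨0, by simp, ?_⟩⟩
      rw [add_zero]
      exact mem_frechetSubdiff_neg_add_indicatorFn (hx.mem (n + 1)) (hx.ne_bot hm hs h0 _)
        (hs.ne_top _) (fun z hz => hx.single_block_optimality hs hf hg n hz) hs.ne_top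
    · exact hx.exists_correction_of_smooth hm hs hf hg hh
  obtain ⟨ε, l, hε, hl, hlip⟩ := hlip
  have hν := hx.νbar_nonneg
  refine ⟨m * (2 * |T| + 2 * νbar + l) + K, by
    have : (0 : ℝ) < m := by exact_mod_cast hm
    positivity, ?_⟩
  -- The sum rule subtracts the ratio gradient at `x (n + 1)`, whereas `proxGrad` contains the one
  -- at `x n`. They can be compared once the step is shorter than `ε`.
  filter_upwards [hτ, hd.eventually_lt_const hε] with n hτn hdn
  obtain ⟨κ, hκ, hmem⟩ := hK n
  obtain ⟨L, hL, hLp⟩ := exists_hasFDerivAt_neg_sum_ratio hs hf hg (hx.mem (n + 1))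
  refine ⟨_, add_mem_frechetSubdiff hmem hL hLp
    (Eventually.of_forall fun z => negObjective_eq z), ?_⟩
  set p : PiLp 2 H := WithLp.toLp 2 fun i => -gradient (fun y => f i y / g i y) (x (n + 1) i)
    with hp
  set D := ‖x (n + 1) - x n‖
  set e := ‖x n - x (n - 1)‖
  have hτ0 : 0 < τ n := hx.δ_pos.trans_le (hx.le_stepsize hm hs n)
  have hτν := hx.stepsize_mul_inertia_le hm hs n
  have hτT : τ n ≤ |T| := hτn.trans (le_abs_self T)
  have h1 : ‖proxGrad f g τ ν x n + p‖ ≤ m * ((2 * |T| + 2 * νbar + l) * (D + e)) := by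
    refine norm_le_card_mul (by positivity) fun i => ?_
    have hDi : ‖x (n + 1) i - x n i‖ ≤ D := PiLp.norm_apply_le (x (n + 1) - x n) i
    have hei : ‖x n i - x (n - 1) i‖ ≤ e := PiLp.norm_apply_le (x n - x (n - 1)) i
    have e1 : (proxGrad f g τ ν x n + p) i =
        ((-(2 * τ n)) • (x (n + 1) i - x n i) + (2 * (τ n * ν n)) • (x n i - x (n - 1) i)) +
        (gradient (fun y => f i y / g i y) (x n i) -
          gradient (fun y => f i y / g i y) (x (n + 1) i)) := by
      simp only [PiLp.add_apply, proxGrad, hp, smul_sub (-(2 * τ n)) _ (ν n • _), smul_smul]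
      have : -(2 * τ n) * ν n = -(2 * (τ n * ν n)) := by ring
      rw [this, neg_smul (2 * (τ n * ν n)), sub_neg_eq_add]
      abel
    have h2 : ‖(-(2 * τ n)) • (x (n + 1) i - x n i)‖ ≤ 2 * |T| * D := by
      rw [norm_smul, norm_neg, Real.norm_eq_abs, abs_of_pos (by positivity)]
      exact mul_le_mul (by linarith) hDi (norm_nonneg _) (by positivity)
    have h3 : ‖(2 * (τ n * ν n)) • (x n i - x (n - 1) i)‖ ≤ 2 * νbar * e := by
      have : 0 ≤ τ n * ν n := mul_nonneg hτ0.le (hx.ν_nonneg n)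
      rw [norm_smul, Real.norm_eq_abs, abs_of_nonneg (by positivity)]
      exact mul_le_mul (by linarith) hei (norm_nonneg _) (by positivity)
    have h4 : ‖gradient (fun y => f i y / g i y) (x n i) -
        gradient (fun y => f i y / g i y) (x (n + 1) i)‖ ≤ l * D := by
      have hDi' : ‖x n i - x (n + 1) i‖ ≤ D := by rwa [norm_sub_rev]
      exact (hlip i _ (hx.mem n i) _ (hx.mem (n + 1) i) (hDi'.trans hdn.le)).trans
        (mul_le_mul_of_nonneg_left hDi' hl.le)
    rw [e1]
    have h5 := norm_add₃_le (a := (-(2 * τ n)) • (x (n + 1) i - x n i))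
      (b := (2 * (τ n * ν n)) • (x n i - x (n - 1) i))
      (c := gradient (fun y => f i y / g i y) (x n i) -
          gradient (fun y => f i y / g i y) (x (n + 1) i))
    have hD0 : 0 ≤ D := norm_nonneg _
    have he0 : 0 ≤ e := norm_nonneg _
    have h6 : 0 ≤ 2 * |T| * e + 2 * νbar * D + l * e := by positivity
    linarith
  have h2 : proxGrad f g τ ν x n + κ + p = (proxGrad f g τ ν x n + p) + κ := by abel
  rw [h2]
  have h3 : K * D ≤ K * (D + e) := mul_le_mul_of_nonneg_left (by simp [e]) hK0
  linarith [norm_add_le (proxGrad f g τ ν x n + p) κ]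

/-- Continuity of `h` along the iterates at a cluster point. -/
theorem IsGenerated.tendsto_coupling (hs : StandingAssumption S h f g a b)
    (hx : IsGenerated S h f g a b δ νbar τ ν x)
    (hf : ∀ i, ∃ O : Set (H i), IsOpen O ∧ S i ⊆ O ∧ ContDiffOn ℝ 1 (f i) O)
    (hg : ∀ i, ∃ O : Set (H i), IsOpen O ∧ S i ⊆ O ∧ ContDiffOn ℝ 1 (g i) O)
    {T : ℝ} (hτ : ∀ᶠ n in atTop, τ n ≤ T)
    (hh : m = 1 ∨ HasLipschitzGradientOn h (feasible S))
    (hd : Tendsto (fun n => ‖x (n + 1) - x n‖) atTop (𝓝 0))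
    {k : ℕ → ℕ} (hk : Tendsto k atTop atTop) {xs : PiLp 2 H} (hxs : xs ∈ feasible S)
    (hlim : Tendsto (fun j => x (k j)) atTop (𝓝 xs))
    (hlim' : Tendsto (fun j => x (k j + 1)) atTop (𝓝 xs)) :
    Tendsto (fun j => h (x (k j + 1))) atTop (𝓝 (h xs)) := by
  rcases hh with rfl | ⟨O, hr, hO, hSO, hhr, hdiff, -⟩
  · have hm : 1 ≤ 1 := le_rfl
    -- For one block, upper semicontinuity of `h` bounds its values from above. Using `xs` as
    -- competitor in the step gives `h xs + t n ≤ h (x (n + 1))`, and `t (k j) → 0` because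
    -- `proxGrad` stays bounded along the subsequence.
    set t : ℕ → ℝ := fun n => ⟪proxGrad f g τ ν x n, xs - x (n + 1)⟫_ℝ
      - τ n * ‖xs - x (n + 1)‖ ^ 2 with ht
    have hν := hx.νbar_nonneg
    have hD : Tendsto (fun j => ‖xs - x (k j + 1)‖) atTop (𝓝 0) := by
      have := (tendsto_const_nhds (x := xs)).sub hlim'
      simpa using this.norm
    have hgrad : Tendsto (fun j => ‖gradient (fun y => f 0 y / g 0 y) (x (k j) 0)‖) atTop
        (𝓝 ‖gradient (fun y => f 0 y / g 0 y) (xs 0)‖) :=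
      ((continuousAt_gradient_ratio hs hf hg (hxs 0)).tendsto.comp
        (((PiLp.continuous_apply 2 H 0).tendsto xs).comp hlim)).norm
    set M : ℝ := ‖gradient (fun y => f 0 y / g 0 y) (xs 0)‖ + 1 with hM
    have hprev : Tendsto (fun n => ‖x n - x (n - 1)‖) atTop (𝓝 0) := by
      rw [← tendsto_add_atTop_iff_nat 1]
      simpa using hd
    have ht0 : Tendsto (fun j => t (k j)) atTop (𝓝 0) := by
      have hbound : Tendsto (fun j => (2 * |T| + 2 * νbar + M) * ‖xs - x (k j + 1)‖
          + |T| * ‖xs - x (k j + 1)‖ ^ 2) atTop (𝓝 0) := by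
        simpa using (hD.const_mul (2 * |T| + 2 * νbar + M)).add ((hD.pow 2).const_mul |T|)
      refine squeeze_zero_norm' ?_ hbound
      filter_upwards [hk.eventually hτ, hk.eventually (hd.eventually_lt_const one_pos),
        hk.eventually (hprev.eventually_lt_const one_pos),
        hgrad.eventually_lt_const (show _ < M by rw [hM]; linarith)] with j h1 h2 h3 h4
      set n := k j
      have hτ0 : 0 < τ n := hx.δ_pos.trans_le (hx.le_stepsize hm hs n)
      have hτν := hx.stepsize_mul_inertia_le hm hs n
      have hτν0 : 0 ≤ τ n * ν n := mul_nonneg hτ0.le (hx.ν_nonneg n)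
      have hτT : τ n ≤ |T| := h1.trans (le_abs_self T)
      have hP : ‖proxGrad f g τ ν x n‖ ≤ 2 * |T| + 2 * νbar + M := by
        have h5 : ‖proxGrad f g τ ν x n‖ ≤ (1 : ℕ) * (2 * |T| + 2 * νbar + M) := by
          refine norm_le_card_mul (by positivity) fun i => ?_
          obtain rfl : i = 0 := Subsingleton.elim _ _
          have hDi : ‖x (n + 1) 0 - x n 0‖ ≤ 1 :=
            (PiLp.norm_apply_le (x (n + 1) - x n) 0).trans h2.le
          have hei : ‖x n 0 - x (n - 1) 0‖ ≤ 1 :=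
            (PiLp.norm_apply_le (x n - x (n - 1)) 0).trans h3.le
          have e1 : proxGrad f g τ ν x n 0 = (-(2 * τ n)) • (x (n + 1) 0 - x n 0) +
              (2 * (τ n * ν n)) • (x n 0 - x (n - 1) 0) +
              gradient (fun y => f 0 y / g 0 y) (x n 0) := by
            simp only [proxGrad, smul_sub (-(2 * τ n)) _ (ν n • _), smul_smul]
            have : -(2 * τ n) * ν n = -(2 * (τ n * ν n)) := by ring
            rw [this, neg_smul (2 * (τ n * ν n)), sub_neg_eq_add]
          rw [e1]
          refine norm_add₃_le.trans ?_
          rw [norm_smul, norm_smul, norm_neg, Real.norm_eq_abs, Real.norm_eq_abs,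
            abs_of_pos (by positivity : 0 < 2 * τ n),
            abs_of_nonneg (by positivity : 0 ≤ 2 * (τ n * ν n))]
          have h6 := mul_le_mul_of_nonneg_left hDi (by positivity : 0 ≤ 2 * τ n)
          have h7 := mul_le_mul_of_nonneg_left hei (by positivity : 0 ≤ 2 * (τ n * ν n))
          linarith
        simpa using h5
      rw [ht]
      refine (norm_sub_le _ _).trans (add_le_add ?_ ?_)
      · exact (norm_inner_le_norm _ _).trans (mul_le_mul_of_nonneg_right hP (norm_nonneg _))
      · rw [Real.norm_eq_abs, abs_of_nonneg (by positivity)]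
        exact mul_le_mul_of_nonneg_right hτT (by positivity)
    have hlow : Tendsto (fun j => h xs + (t (k j) : EReal)) atTop (𝓝 (h xs)) := by
      have h1 : Tendsto (fun j => ((t (k j) : ℝ) : EReal)) atTop (𝓝 ((0 : ℝ) : EReal)) :=
        (continuous_coe_real_ereal.tendsto 0).comp ht0
      have h2 := (EReal.continuousAt_add (p := (h xs, ((0 : ℝ) : EReal)))
        (Or.inr (EReal.coe_ne_bot 0))
        (Or.inr (EReal.coe_ne_top 0))).tendsto.comp
        ((tendsto_const_nhds (x := h xs)).prodMk_nhds h1)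
      simpa [Function.comp_def] using h2
    refine tendsto_order.2 ⟨fun c hc => ?_, fun c hc => ?_⟩
    · filter_upwards [hlow.eventually_const_lt hc] with j hj
      exact hj.trans_le (hx.single_block_optimality hs hf hg (k j) hxs)
    · have h1 : -c < -h xs := EReal.neg_lt_neg_iff.2 hc
      filter_upwards [hlim'.eventually (hs.lsc xs _ h1)] with j hj
      exact EReal.neg_lt_neg_iff.1 hj
  · have hc : ContinuousAt hr xs := (hdiff.differentiableAt (hO.mem_nhds (hSO hxs))).continuousAt
    rw [hhr xs (hSO hxs)]
    have h1 := (continuous_coe_real_ereal.tendsto (hr xs)).comp (hc.tendsto.comp hlim')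
    refine h1.congr fun j => ?_
    rw [hhr _ (hSO (hx.mem _))]
    rfl

end Generated

/-! ### Abstract descent sequences under the KL inequality. -/

section Descent

variable {E : Type*} [NormedAddCommGroup E] [InnerProductSpace ℝ E]

/-- A sequence `x` with cluster point `xs` satisfying, for a function `Φ` of two consecutive
iterates with value gaps `r`, the sufficient decrease and relative error conditions. -/
structure IsDescentSequence (Φ : WithLp 2 (E × E) → EReal) (x : ℕ → E) (xs : E) (r : ℕ → ℝ)
    (v c C : ℝ) : Prop where
  c_pos : 0 < c
  C_pos : 0 < C
  gap_nonneg : ∀ n, 0 ≤ r n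
  gap_tendsto : Tendsto r atTop (𝓝 0)
  descent : ∀ n, c * ‖x (n + 1) - x n‖ ^ 2 ≤ r n - r (n + 1)
  cluster : MapClusterPt xs atTop x
  value_limit : Φ (WithLp.toLp 2 (xs, xs)) = (v : EReal)
  value : ∀ n, Φ (WithLp.toLp 2 (x (n + 1), x n)) = ((v + r (n + 1) : ℝ) : EReal)
  subgradient : ∀ᶠ n in atTop, ∃ U ∈ frechetSubdiff Φ (WithLp.toLp 2 (x (n + 2), x (n + 1))),
    ‖U‖ ≤ C * (‖x (n + 2) - x (n + 1)‖ + ‖x (n + 1) - x n‖)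

namespace IsDescentSequence

variable {Φ : WithLp 2 (E × E) → EReal} {x : ℕ → E} {xs : E} {r : ℕ → ℝ} {v c C : ℝ}

theorem gap_antitone (hx : IsDescentSequence Φ x xs r v c C) : Antitone r :=
  antitone_nat_of_succ_le fun n => by
    have h1 := hx.descent n
    have h2 : 0 ≤ c * ‖x (n + 1) - x n‖ ^ 2 := mul_nonneg hx.c_pos.le (sq_nonneg _)
    linarith

theorem step_sq_le (hx : IsDescentSequence Φ x xs r v c C) (n : ℕ) :
    ‖x (n + 1) - x n‖ ^ 2 ≤ r n / c := by
  rw [le_div_iff₀ hx.c_pos]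
  linarith [hx.descent n, hx.gap_nonneg (n + 1)]

theorem step_le (hx : IsDescentSequence Φ x xs r v c C) (n : ℕ) :
    ‖x (n + 1) - x n‖ ≤ √(r n) / √c := by
  rw [← Real.sqrt_div (hx.gap_nonneg n)]
  exact Real.le_sqrt_of_sq_le (hx.step_sq_le n)

theorem step_tendsto (hx : IsDescentSequence Φ x xs r v c C) :
    Tendsto (fun n => ‖x (n + 1) - x n‖) atTop (𝓝 0) := by
  refine squeeze_zero (fun _ => norm_nonneg _) hx.step_le ?_
  simpa using hx.gap_tendsto.sqrt.div_const √c

/-- The consequences of a desingularization function near the cluster point. -/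
theorem exists_three_term (hx : IsDescentSequence Φ x xs r v c C) {φ : ℝ → ℝ}
    (hφ : IsDesingularizing Φ (WithLp.toLp 2 (xs, xs)) φ) :
    ∃ ρ : ℝ, 0 < ρ ∧ ∃ N : ℕ, (∀ n ≥ N, 0 ≤ φ (r n)) ∧
      Tendsto (fun n => φ (r n)) atTop (𝓝 0) ∧
      ∀ n ≥ N, ‖x (n + 1) - xs‖ < ρ → ‖x (n + 2) - xs‖ < ρ →
        (0 < r (n + 2) → 1 ≤ deriv φ (r (n + 2)) *
          (C * (‖x (n + 2) - x (n + 1)‖ + ‖x (n + 1) - x n‖))) ∧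
        ‖x (n + 3) - x (n + 2)‖ ≤ (‖x (n + 2) - x (n + 1)‖ + ‖x (n + 1) - x n‖) / 4
          + C / c * (φ (r (n + 2)) - φ (r (n + 3))) := by
  obtain ⟨U, hU, η, hη, hnonneg, h0, hcont, hconc, hdiff, hder, hKL⟩ := hφ
  obtain ⟨ε, hε, hball⟩ := Metric.mem_nhds_iff.1 hU
  have hrη : ∀ᶠ n in atTop, (r n : EReal) < η := by
    have : Tendsto (fun n => (r n : EReal)) atTop (𝓝 0) :=
      (continuous_coe_real_ereal.tendsto 0).comp hx.gap_tendsto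
    exact this.eventually_lt_const hη
  obtain ⟨N, hN⟩ := eventually_atTop.1 (hrη.and hx.subgradient)
  have hmem : ∀ n ≥ N, r n ∈ {s : ℝ | 0 ≤ s ∧ (s : EReal) < η} := fun n hn =>
    ⟨hx.gap_nonneg n, (hN n hn).1⟩
  -- The pair `(x (n + 2), x (n + 1))` is within the sum of two distances of `(xs, xs)`, hence
  -- radius `ε / 2` for each.
  refine ⟨ε / 2, by positivity, N, fun n hn => hnonneg _ (hx.gap_nonneg n) (hN n hn).1, ?_, ?_⟩
  · have h1 : ContinuousWithinAt φ {s : ℝ | 0 ≤ s ∧ (s : EReal) < η} 0 :=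
      hcont 0 ⟨le_rfl, by simpa using hη⟩
    have h2 := h1.tendsto.comp (tendsto_nhdsWithin_iff.2
      ⟨hx.gap_tendsto, eventually_atTop.2 ⟨N, hmem⟩⟩)
    rwa [h0] at h2
  intro n hn hb1 hb2
  have hopen : IsOpen {s : ℝ | 0 < s ∧ (s : EReal) < η} :=
    isOpen_Ioi.inter (isOpen_Iio.preimage continuous_coe_real_ereal)
  have hlt : (r (n + 2) : EReal) < η := (hN (n + 2) (by omega)).1
  have hstep : 0 < r (n + 2) → 1 ≤ deriv φ (r (n + 2)) *
      (C * (‖x (n + 2) - x (n + 1)‖ + ‖x (n + 1) - x n‖)) := by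
    intro hpos
    obtain ⟨u, hu, hunorm⟩ := (hN n hn).2
    have hder' := (hder _ hpos hlt).le
    have hval := hx.value (n + 1)
    have hP : WithLp.toLp 2 (x (n + 2), x (n + 1)) ∈ U := by
      refine hball ?_
      rw [Metric.mem_ball, dist_eq_norm]
      have e1 : WithLp.toLp 2 (x (n + 2), x (n + 1)) - WithLp.toLp 2 (xs, xs) =
          WithLp.toLp 2 (x (n + 2) - xs, (0 : E)) + WithLp.toLp 2 ((0 : E), x (n + 1) - xs) := by
        rw [← WithLp.toLp_sub, ← WithLp.toLp_add]
        simp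
      rw [e1]
      refine (norm_add_le _ _).trans_lt ?_
      rw [WithLp.norm_toLp_fst, WithLp.norm_toLp_snd]
      linarith
    have hkl := hKL _ hP (by
      rw [hval, hx.value_limit, EReal.coe_lt_coe_iff]; linarith) (by
      rw [hval, hx.value_limit, EReal.coe_add]
      exact EReal.add_lt_add_left_coe hlt v)
    rw [hval, hx.value_limit, ← EReal.coe_sub, EReal.toReal_coe, add_sub_cancel_left] at hkl
    exact (one_le_deriv_mul_norm hkl hu hder').trans (mul_le_mul_of_nonneg_left hunorm hder')
  refine ⟨hstep, ?_⟩
  exact three_term_of_desingularizing hx.c_pos hx.C_pos.le hconc (hmem _ (by omega))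
    (hmem _ (by omega)) (hx.gap_nonneg _) (by positivity) (hx.descent (n + 2))
    (fun hpos => (hdiff.differentiableOn one_ne_zero).differentiableAt
      (hopen.mem_nhds ⟨hpos, hlt⟩))
    (fun hpos => (hder _ hpos hlt).le) hstep

/-- The recursion is only valid near `xs`; trapping makes it valid for all large `n`, summability
follows, and a Cauchy sequence converges to its cluster point. -/
theorem summable_and_tendsto [CompleteSpace E] (hx : IsDescentSequence Φ x xs r v c C) {φ : ℝ → ℝ}
    (hφ : IsDesingularizing Φ (WithLp.toLp 2 (xs, xs)) φ) :
    Summable (fun n => ‖x (n + 1) - x n‖) ∧ Tendsto x atTop (𝓝 xs) := by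
  obtain ⟨ρ, hρ, N, hs, hs0, h⟩ := hx.exists_three_term hφ
  have hK : 0 ≤ C / c := (div_pos hx.C_pos hx.c_pos).le
  have hev := eventually_mem_ball_of_three_term hK hρ hs hs0 hx.step_tendsto hx.cluster
    fun n hn h1 h2 => (h n hn h1 h2).2
  obtain ⟨N', hN'⟩ := eventually_atTop.1 hev
  have hsum : Summable (fun n => ‖x (n + 1) - x n‖) :=
    (summable_of_three_term (s := fun n => φ (r n)) (N₀ := max N N') hK (fun n => norm_nonneg _)
      (fun n hn => hs n (le_of_max_le_left hn))
      fun n hn => (h n (le_of_max_le_left hn) (hN' _ (by have := le_of_max_le_right hn; omega))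
        (hN' _ (by have := le_of_max_le_right hn; omega))).2).1
  refine ⟨hsum, ?_⟩
  have hcau : CauchySeq x := cauchySeq_of_summable_dist (by
    simpa [dist_eq_norm, norm_sub_rev] using hsum)
  obtain ⟨y, hy⟩ := cauchySeq_tendsto_of_complete hcau
  have : xs = y := eq_of_nhds_neBot (ClusterPt.mono hx.cluster hy)
  rwa [this]

/-- The estimates available once the sequence is known to converge. -/
theorem eventually_tail_le (hx : IsDescentSequence Φ x xs r v c C) {φ : ℝ → ℝ}
    (hφ : IsDesingularizing Φ (WithLp.toLp 2 (xs, xs)) φ) (hlim : Tendsto x atTop (𝓝 xs)) :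
    (∀ᶠ n in atTop, 0 < r (n + 2) → 1 ≤ deriv φ (r (n + 2)) *
      (C * (‖x (n + 2) - x (n + 1)‖ + ‖x (n + 1) - x n‖))) ∧
    ∀ᶠ n in atTop, ‖x n - xs‖ ≤ 3 / 2 * ‖x (n + 1) - x n‖ + 2 * ‖x (n + 2) - x (n + 1)‖
      + 2 * (C / c) * φ (r (n + 2)) := by
  obtain ⟨ρ, hρ, N, hs, hs0, h⟩ := hx.exists_three_term hφ
  have hK : 0 ≤ C / c := (div_pos hx.C_pos hx.c_pos).le
  obtain ⟨N', hN'⟩ := eventually_atTop.1 (hlim.eventually (Metric.ball_mem_nhds xs hρ))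
  have hball : ∀ n ≥ N', ‖x n - xs‖ < ρ := fun n hn => by
    simpa [dist_eq_norm] using hN' n hn
  have hall : ∀ n ≥ max N N', _ := fun n hn => h n (le_of_max_le_left hn)
    (hball _ (by have := le_of_max_le_right hn; omega))
    (hball _ (by have := le_of_max_le_right hn; omega))
  obtain ⟨hsum, htail⟩ := summable_of_three_term (d := fun n => ‖x (n + 1) - x n‖)
    (s := fun n => φ (r n)) (N₀ := max N N') hK
    (fun n => norm_nonneg _) (fun n hn => hs n (le_of_max_le_left hn)) fun n hn => (hall n hn).2
  refine ⟨eventually_atTop.2 ⟨max N N', fun n hn => (hall n hn).1⟩,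
    eventually_atTop.2 ⟨max N N', fun n hn => ?_⟩⟩
  have h1 := dist_le_tsum_of_dist_le_of_tendsto (fun n => ‖x (n + 1) - x n‖)
    (fun n => by rw [dist_eq_norm, norm_sub_rev]) hsum hlim n
  rw [dist_eq_norm] at h1
  exact h1.trans (htail n hn)

theorem deriv_mul_rpow {γ α s : ℝ} (hs : 0 < s) :
    deriv (fun s : ℝ => γ * s ^ (1 - α)) s = γ * (1 - α) * (s ^ α)⁻¹ := by
  have h1 : HasDerivAt (fun s : ℝ => γ * s ^ (1 - α)) (γ * ((1 - α) * s ^ (1 - α - 1))) s :=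
    (Real.hasDerivAt_rpow_const (Or.inl hs.ne')).const_mul γ
  rw [h1.deriv, sub_sub_cancel_left, Real.rpow_neg hs.le]
  ring

section Exponent

variable {γ α : ℝ}

theorem eventually_rpow_le (hx : IsDescentSequence Φ x xs r v c C)
    (hφ : IsDesingularizing Φ (WithLp.toLp 2 (xs, xs)) fun s => γ * s ^ (1 - α))
    (hlim : Tendsto x atTop (𝓝 xs)) :
    ∀ᶠ n in atTop, 0 < r (n + 2) → r (n + 2) ^ α ≤
      γ * (1 - α) * C * (‖x (n + 2) - x (n + 1)‖ + ‖x (n + 1) - x n‖) := by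
  filter_upwards [(hx.eventually_tail_le hφ hlim).1] with n hn hpos
  have h1 := hn hpos
  rw [deriv_mul_rpow hpos] at h1
  have h2 : 0 < r (n + 2) ^ α := Real.rpow_pos_of_pos hpos _
  have h3 := mul_le_mul_of_nonneg_right h1 h2.le
  rw [one_mul] at h3
  refine h3.trans (le_of_eq ?_)
  field_simp

/-- Finite termination for exponent zero. -/
theorem eventually_eq (hx : IsDescentSequence Φ x xs r v c C)
    (hφ : IsDesingularizing Φ (WithLp.toLp 2 (xs, xs)) fun s => γ * s ^ (1 - (0 : ℝ)))
    (hlim : Tendsto x atTop (𝓝 xs)) : ∃ n₀ : ℕ, ∀ n ≥ n₀, x n = xs := by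
  have hd := hx.step_tendsto
  have hsmall : Tendsto (fun n => γ * (1 - 0) * C *
      (‖x (n + 2) - x (n + 1)‖ + ‖x (n + 1) - x n‖)) atTop (𝓝 0) := by
    simpa using (((tendsto_add_atTop_iff_nat 1).2 hd).add hd).const_mul (γ * (1 - 0) * C)
  obtain ⟨N, hN⟩ := eventually_atTop.1
    ((hx.eventually_rpow_le hφ hlim).and (hsmall.eventually_lt_const one_pos))
  -- For a positive gap the KL bound reads `1 ≤` a quantity tending to `0`. So the gap vanishes, and
  -- the descent inequality then stops the iterates.
  have hr : ∀ n ≥ N + 2, r n = 0 := by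
    intro n hn
    obtain ⟨k, rfl⟩ : ∃ k, n = k + 2 := ⟨n - 2, by omega⟩
    by_contra hne
    have hpos : 0 < r (k + 2) := lt_of_le_of_ne (hx.gap_nonneg _) (Ne.symm hne)
    have h1 := hN k (by omega)
    have h2 := h1.1 hpos
    rw [Real.rpow_zero] at h2
    linarith [h1.2]
  refine ⟨N + 2, fun n hn => ?_⟩
  have hconst : ∀ k, x (n + k) = x n := by
    intro k
    induction k with
    | zero => rfl
    | succ k ih =>
      have h1 := hx.step_sq_le (n + k)
      rw [hr _ (by omega), zero_div] at h1
      have h2 : ‖x (n + k + 1) - x (n + k)‖ = 0 :=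
        pow_eq_zero_iff two_ne_zero |>.1 (le_antisymm h1 (sq_nonneg _))
      rw [← ih]
      exact sub_eq_zero.1 (norm_eq_zero.1 h2)
  have h1 : Tendsto (fun k => x (n + k)) atTop (𝓝 xs) := by
    simpa [add_comm] using (tendsto_add_atTop_iff_nat n).2 hlim
  simp only [hconst] at h1
  exact tendsto_nhds_unique tendsto_const_nhds h1

/-- The KL bound at `n + 2` involves the two preceding steps `p`, `q`. Squaring it, `(p + q)² ≤ 2
(p² + q²)` and two descent inequalities bring in `r n - r (n + 2)`. -/
theorem exists_two_step (hx : IsDescentSequence Φ x xs r v c C) (hγ : 0 < γ) (hα0 : 0 < α)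
    (hα1 : α < 1) (hφ : IsDesingularizing Φ (WithLp.toLp 2 (xs, xs)) fun s => γ * s ^ (1 - α))
    (hlim : Tendsto x atTop (𝓝 xs)) :
    ∃ K : ℝ, 0 < K ∧ ∃ N : ℕ, ∀ n ≥ N, r (n + 2) ^ (2 * α) ≤ K * (r n - r (n + 2)) := by
  set A := γ * (1 - α) * C with hA
  have hA0 : 0 < A := mul_pos (mul_pos hγ (by linarith)) hx.C_pos
  have hc := hx.c_pos
  obtain ⟨N, hN⟩ := eventually_atTop.1 (hx.eventually_rpow_le hφ hlim)
  refine ⟨2 * A ^ 2 / c, by positivity, N, fun n hn => ?_⟩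
  have hle : r (n + 2) ≤ r n := hx.gap_antitone (by omega)
  rcases (hx.gap_nonneg (n + 2)).eq_or_lt with h0 | hpos
  · rw [← h0, Real.zero_rpow (by positivity)]
    exact mul_nonneg (by positivity) (by linarith)
  · have h1 := hN n hn hpos
    set p := ‖x (n + 2) - x (n + 1)‖
    set q := ‖x (n + 1) - x n‖
    have h2 : r (n + 2) ^ (2 * α) = (r (n + 2) ^ α) ^ 2 := by
      rw [mul_comm, Real.rpow_mul hpos.le, Real.rpow_two]
    have h3 : (r (n + 2) ^ α) ^ 2 ≤ (A * (p + q)) ^ 2 :=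
      pow_le_pow_left₀ (Real.rpow_nonneg hpos.le _) h1 2
    have h4 : c * (p ^ 2 + q ^ 2) ≤ r n - r (n + 2) := by
      have := hx.descent n
      have := hx.descent (n + 1)
      linarith
    rw [h2]
    calc _ ≤ (A * (p + q)) ^ 2 := h3
      _ = A ^ 2 * (p + q) ^ 2 := by ring
      _ ≤ A ^ 2 * (2 * (p ^ 2 + q ^ 2)) :=
        mul_le_mul_of_nonneg_left (by nlinarith [sq_nonneg (p - q)]) (sq_nonneg _)
      _ = 2 * A ^ 2 / c * (c * (p ^ 2 + q ^ 2)) := by field_simp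
      _ ≤ _ := mul_le_mul_of_nonneg_left h4 (by positivity)

/-- If `2α ≤ 1` and `r < 1`, then `r ≤ r^(2α)` and the two-step recursion becomes linear. Steps are
at most `√(r / c)`, so a geometric series with ratio `√ρ` bounds the distance. -/
theorem exists_linear_rate (hx : IsDescentSequence Φ x xs r v c C) (hγ : 0 < γ) (hα0 : 0 < α)
    (hα1 : α ≤ 1 / 2) (hφ : IsDesingularizing Φ (WithLp.toLp 2 (xs, xs)) fun s => γ * s ^ (1 - α))
    (hlim : Tendsto x atTop (𝓝 xs)) :
    ∃ B ρ : ℝ, 0 < B ∧ 0 < ρ ∧ ρ < 1 ∧ ∀ n : ℕ,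
      ‖x n - xs‖ ≤ B * ρ ^ ((n : ℝ) / 2) ∧ r n ≤ B * ρ ^ n := by
  obtain ⟨K, hK, N, hN⟩ := hx.exists_two_step hγ hα0 (by linarith) hφ hlim
  obtain ⟨N', hN'⟩ := eventually_atTop.1 (hx.gap_tendsto.eventually_lt_const one_pos)
  obtain ⟨B, ρ, hB, hρ0, hρ1, hbound⟩ := exists_geometric_bound (N := max N N') hK hx.gap_nonneg
    hx.gap_antitone fun n hn => by
      have h1 := hN n (le_of_max_le_left hn)
      have h2 : r (n + 2) < 1 := hN' _ (by have := le_of_max_le_right hn; omega)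
      refine le_trans ?_ h1
      rcases (hx.gap_nonneg (n + 2)).eq_or_lt with h0 | hpos
      · rw [← h0, Real.zero_rpow (by positivity)]
      · exact Real.self_le_rpow_of_le_one hpos.le h2.le (by linarith)
  have hσ1 : √ρ < 1 := by rw [Real.sqrt_lt' one_pos]; simpa using hρ1
  have hσ0 : 0 < √ρ := Real.sqrt_pos.2 hρ0
  have hc : 0 < √c := Real.sqrt_pos.2 hx.c_pos
  have hpow : ∀ n : ℕ, √(ρ ^ n) = √ρ ^ n := fun n => by
    have : ρ ^ n = (√ρ ^ n) ^ 2 := by rw [← pow_mul, mul_comm, pow_mul, Real.sq_sqrt hρ0.le]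
    rw [this, Real.sqrt_sq (by positivity)]
  have hstep : ∀ n, dist (x n) (x (n + 1)) ≤ √B / √c * √ρ ^ n := by
    intro n
    rw [dist_eq_norm, norm_sub_rev]
    refine (hx.step_le n).trans ?_
    rw [div_mul_eq_mul_div]
    refine div_le_div_of_nonneg_right ?_ hc.le
    calc √(r n) ≤ √(B * ρ ^ n) := Real.sqrt_le_sqrt (hbound n)
      _ = √B * √ρ ^ n := by rw [Real.sqrt_mul hB.le, hpow]
  have hdist := dist_le_of_le_geometric_of_tendsto √ρ (√B / √c) hσ1 hstep hlim
  refine ⟨max B (√B / √c / (1 - √ρ)), ρ, lt_max_of_lt_left hB, hρ0, hρ1, fun n => ⟨?_, ?_⟩⟩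
  · have h1 := hdist n
    rw [dist_eq_norm] at h1
    have h2 : ρ ^ ((n : ℝ) / 2) = √ρ ^ n := by
      rw [Real.sqrt_eq_rpow, ← Real.rpow_natCast, ← Real.rpow_mul hρ0.le]
      congr 1
      ring
    rw [h2]
    calc ‖x n - xs‖ ≤ √B / √c / (1 - √ρ) * √ρ ^ n := h1.trans (le_of_eq (by ring))
      _ ≤ _ := mul_le_mul_of_nonneg_right (le_max_right _ _) (by positivity)
  · exact (hbound n).trans (mul_le_mul_of_nonneg_right (le_max_left _ _) (by positivity))

/-- The recursion with exponent `2α > 1` gives a gap of order `n^(-1/(2α-1))`. In the tail estimate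
`r^(1-α)` dominates `√r` for `r < 1`, since `1 - α < 1/2`, and this gives the rate of the distance.
-/
theorem exists_sublinear_rate (hx : IsDescentSequence Φ x xs r v c C) (hγ : 0 < γ)
    (hα0 : 1 / 2 < α) (hα1 : α < 1)
    (hφ : IsDesingularizing Φ (WithLp.toLp 2 (xs, xs)) fun s => γ * s ^ (1 - α))
    (hlim : Tendsto x atTop (𝓝 xs)) :
    ∃ B : ℝ, 0 < B ∧ ∀ n : ℕ,
      ‖x n - xs‖ ≤ B * ((n : ℝ) + 1) ^ (-((1 - α) / (2 * α - 1))) ∧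
      r n ≤ B * ((n : ℝ) + 1) ^ (-((2 - 2 * α) / (2 * α - 1))) := by
  have hα' : 0 < 2 * α - 1 := by linarith
  obtain ⟨K, hK, N, hN⟩ := hx.exists_two_step hγ (by linarith) hα1 hφ hlim
  obtain ⟨B, hB, hbound⟩ := exists_rpow_bound hK (by linarith : 1 < 2 * α) (by linarith)
    hx.gap_nonneg hx.gap_antitone hN
  have hc : 0 < √c := Real.sqrt_pos.2 hx.c_pos
  have hCc : 0 < C / c := div_pos hx.C_pos hx.c_pos
  -- the distance is eventually controlled by a power of the gap
  set D : ℝ := 4 / √c + 2 * (C / c) * γ with hD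
  have hD0 : 0 < D := by positivity
  obtain ⟨M, hM⟩ : ∃ M : ℕ, ∀ n ≥ M, ‖x n - xs‖ ≤ D * r n ^ (1 - α) := by
    refine eventually_atTop.1 ?_
    filter_upwards [(hx.eventually_tail_le hφ hlim).2,
      hx.gap_tendsto.eventually_lt_const one_pos] with n hn hn1
    have hsq : √(r n) ≤ r n ^ (1 - α) := by
      rcases (hx.gap_nonneg n).eq_or_lt with h0 | hpos
      · rw [← h0, Real.sqrt_zero, Real.zero_rpow (by linarith)]
      · rw [Real.sqrt_eq_rpow]
        exact Real.rpow_le_rpow_of_exponent_ge hpos hn1.le (by linarith)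
    have h1 : ‖x (n + 1) - x n‖ ≤ r n ^ (1 - α) / √c :=
      (hx.step_le n).trans (div_le_div_of_nonneg_right hsq hc.le)
    have h2 : ‖x (n + 2) - x (n + 1)‖ ≤ r n ^ (1 - α) / √c :=
      (hx.step_le (n + 1)).trans (div_le_div_of_nonneg_right
        ((Real.sqrt_le_sqrt (hx.gap_antitone (Nat.le_succ n))).trans hsq) hc.le)
    have h3 : r (n + 2) ^ (1 - α) ≤ r n ^ (1 - α) :=
      Real.rpow_le_rpow (hx.gap_nonneg _) (hx.gap_antitone (by omega)) (by linarith)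
    have h4 : 2 * (C / c) * (γ * r (n + 2) ^ (1 - α)) ≤ 2 * (C / c) * (γ * r n ^ (1 - α)) := by
      gcongr
    have h5 : 0 ≤ r n ^ (1 - α) / √c := div_nonneg (Real.rpow_nonneg (hx.gap_nonneg n) _) hc.le
    have h6 : D * r n ^ (1 - α) = 4 * (r n ^ (1 - α) / √c) +
        2 * (C / c) * (γ * r n ^ (1 - α)) := by rw [hD]; ring
    rw [h6]
    linarith
  have hgap : ∀ n : ℕ, r n ^ (1 - α) ≤
      B ^ (1 - α) * ((n : ℝ) + 1) ^ (-((1 - α) / (2 * α - 1))) := by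
    intro n
    have hn : (0 : ℝ) ≤ (n : ℝ) + 1 := by positivity
    calc r n ^ (1 - α) ≤ (B * ((n : ℝ) + 1) ^ (-(1 / (2 * α - 1)))) ^ (1 - α) :=
          Real.rpow_le_rpow (hx.gap_nonneg n) (hbound n) (by linarith)
      _ = _ := by
          rw [Real.mul_rpow hB.le (by positivity), ← Real.rpow_mul hn]
          congr 2
          ring
  -- `Q` absorbs the finitely many indices before the tail estimate becomes valid.
  set Q : ℝ := ∑ k ∈ Finset.range M, ‖x k - xs‖ * ((k : ℝ) + 1) ^ ((1 - α) / (2 * α - 1)) with hQ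
  have hQ0 : 0 ≤ Q := Finset.sum_nonneg fun k _ => by positivity
  refine ⟨max B (D * B ^ (1 - α) + Q), lt_max_of_lt_left hB, fun n => ⟨?_, ?_⟩⟩
  · have hn : (0 : ℝ) < (n : ℝ) + 1 := by positivity
    refine le_trans ?_ (mul_le_mul_of_nonneg_right (le_max_right _ _) (by positivity))
    have hp : 0 < ((n : ℝ) + 1) ^ (-((1 - α) / (2 * α - 1))) := Real.rpow_pos_of_pos hn _
    have hDB : 0 ≤ D * B ^ (1 - α) := by positivity
    by_cases hnM : M ≤ n
    · calc ‖x n - xs‖ ≤ D * r n ^ (1 - α) := hM n hnM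
        _ ≤ D * (B ^ (1 - α) * ((n : ℝ) + 1) ^ (-((1 - α) / (2 * α - 1)))) :=
          mul_le_mul_of_nonneg_left (hgap n) hD0.le
        _ = D * B ^ (1 - α) * ((n : ℝ) + 1) ^ (-((1 - α) / (2 * α - 1))) := by ring
        _ ≤ _ := mul_le_mul_of_nonneg_right (by linarith) hp.le
    · have h1 : ‖x n - xs‖ * ((n : ℝ) + 1) ^ ((1 - α) / (2 * α - 1)) ≤ Q :=
        Finset.single_le_sum
          (f := fun k : ℕ => ‖x k - xs‖ * ((k : ℝ) + 1) ^ ((1 - α) / (2 * α - 1)))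
          (fun k _ => by positivity) (Finset.mem_range.2 (not_le.1 hnM))
      have h2 : ‖x n - xs‖ = ‖x n - xs‖ * ((n : ℝ) + 1) ^ ((1 - α) / (2 * α - 1)) *
          ((n : ℝ) + 1) ^ (-((1 - α) / (2 * α - 1))) := by
        rw [mul_assoc, ← Real.rpow_add hn, add_neg_cancel, Real.rpow_zero, mul_one]
      rw [h2]
      exact mul_le_mul_of_nonneg_right (by linarith) hp.le
  -- The gap decays with exponent `1/(2α-1)`, which is at least the required one because `2 - 2α ≤
  -- 1`.
  · refine (hbound n).trans (mul_le_mul (le_max_left _ _) ?_ (by positivity)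
      (le_max_of_le_left hB.le))
    refine Real.rpow_le_rpow_of_exponent_le (by simp) ?_
    rw [neg_le_neg_iff]
    exact div_le_div_of_nonneg_right (by linarith) hα'.le

end Exponent

end IsDescentSequence

end Descent

/-! ### The algorithm generates a descent sequence. -/

section Convergence

variable {m : ℕ} {H : Fin m → Type*} [∀ i, NormedAddCommGroup (H i)]
  [∀ i, InnerProductSpace ℝ (H i)] [∀ i, FiniteDimensional ℝ (H i)]
  {S : ∀ i, Set (H i)} {h : PiLp 2 H → EReal} {f g : ∀ i, H i → ℝ} {a b : Fin m → ℝ}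
  {δ νbar : ℝ} {τ ν : ℕ → ℝ} {x : ℕ → PiLp 2 H}

/-- The iterates have a stationary cluster point, along which the merit function satisfies the
sufficient decrease and relative error conditions. -/
theorem IsGenerated.exists_isDescentSequence (hm : 1 ≤ m) (hs : StandingAssumption S h f g a b)
    (hx : IsGenerated S h f g a b δ νbar τ ν x) (h0 : h (x 0) ≠ ⊥)
    (hbdd : ∃ M : ℝ, ∀ z ∈ feasible S, objective h f g z ≤ (M : EReal))
    (hlevel : Bornology.IsBounded {z | z ∈ feasible S ∧ objective h f g (x 0) ≤ objective h f g z})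
    (hf : ∀ i, ∃ O : Set (H i), IsOpen O ∧ S i ⊆ O ∧ ContDiffOn ℝ 1 (f i) O)
    (hg : ∀ i, ∃ O : Set (H i), IsOpen O ∧ S i ⊆ O ∧ ContDiffOn ℝ 1 (g i) O)
    (hτ : limsup (fun n => (τ n : EReal)) atTop < ⊤)
    (hh : m = 1 ∨ HasLipschitzGradientOn h (feasible S))
    (hlip : ∃ ε l : ℝ, 0 < ε ∧ 0 < l ∧ ∀ i, ∀ z ∈ S i, ∀ z' ∈ S i, ‖z - z'‖ ≤ ε →
      ‖gradient (fun y => f i y / g i y) z - gradient (fun y => f i y / g i y) z'‖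
        ≤ l * ‖z - z'‖) :
    ∃ (xs : PiLp 2 H) (C : ℝ), IsStationary S h f g xs ∧ h xs ≠ ⊥ ∧
      IsDescentSequence (merit S h f g νbar) x xs
        (fun n => -realObjective h f g (x n) + νbar * ‖x n - x (n - 1)‖ ^ 2
          + realObjective h f g xs) (-realObjective h f g xs) (δ - 2 * νbar) C := by
  have hfin := hx.ne_bot hm hs h0
  have hν := hx.νbar_nonneg
  have hc : 0 < δ - 2 * νbar := by linarith [hx.νbar_lt]
  have hdesc := hx.descent hm hs h0
  set Fr : PiLp 2 H → ℝ := realObjective h f g with hFr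
  set G : ℕ → ℝ := fun n => -Fr (x n) + νbar * ‖x n - x (n - 1)‖ ^ 2 with hG
  have hdescG : ∀ n, (δ - 2 * νbar) * ‖x (n + 1) - x n‖ ^ 2 ≤ G n - G (n + 1) := hdesc
  have hobj : ∀ n, objective h f g (x n) = (Fr (x n) : EReal) := fun n =>
    objective_eq_coe (hfin n) (hs.ne_top _)
  have hanti : Antitone G := antitone_nat_of_succ_le fun n => by
    have := hdescG n
    have : 0 ≤ (δ - 2 * νbar) * ‖x (n + 1) - x n‖ ^ 2 := by positivity
    linarith
  obtain ⟨M, hM⟩ := hbdd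
  have hFM : ∀ n, Fr (x n) ≤ M := fun n => by
    have := hM _ (hx.mem n)
    rwa [hobj, EReal.coe_le_coe_iff] at this
  have hGbdd : BddBelow (Set.range G) := by
    refine ⟨-M, ?_⟩
    rintro _ ⟨n, rfl⟩
    have : 0 ≤ νbar * ‖x n - x (n - 1)‖ ^ 2 := by positivity
    linarith [hFM n]
  have hGlim := tendsto_atTop_ciInf hanti hGbdd
  set L := ⨅ n, G n
  have hd : Tendsto (fun n => ‖x (n + 1) - x n‖) atTop (𝓝 0) := by
    have h1 : Tendsto (fun n => (G n - G (n + 1)) / (δ - 2 * νbar)) atTop (𝓝 0) := by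
      simpa using (hGlim.sub ((tendsto_add_atTop_iff_nat 1).2 hGlim)).div_const (δ - 2 * νbar)
    have h2 : Tendsto (fun n => ‖x (n + 1) - x n‖ ^ 2) atTop (𝓝 0) := by
      refine squeeze_zero (fun _ => sq_nonneg _) (fun n => ?_) h1
      rw [le_div_iff₀ hc, mul_comm]
      exact hdescG n
    simpa [Real.sqrt_sq (norm_nonneg _)] using h2.sqrt
  -- Since `x_{-1} = x_0`, the inertial term vanishes in `G 0`, so all iterates remain in the
  -- bounded level set.
  have hF0 : ∀ n, Fr (x 0) ≤ Fr (x n) := fun n => by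
    have h1 : G n ≤ G 0 := hanti (Nat.zero_le n)
    have h2 : G 0 = -Fr (x 0) := by simp [hG]
    have : 0 ≤ νbar * ‖x n - x (n - 1)‖ ^ 2 := by positivity
    have h3 : G n = -Fr (x n) + νbar * ‖x n - x (n - 1)‖ ^ 2 := rfl
    linarith
  obtain ⟨xs, -, k, hk, hklim⟩ := tendsto_subseq_of_bounded hlevel (x := x) fun n =>
    ⟨hx.mem n, by rw [hobj, hobj]; exact EReal.coe_le_coe_iff.2 (hF0 n)⟩
  have hktop : Tendsto k atTop atTop := hk.tendsto_atTop
  have hlim : Tendsto (fun j => x (k j)) atTop (𝓝 xs) := hklim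
  have hlim' : Tendsto (fun j => x (k j + 1)) atTop (𝓝 xs) := by
    have h1 : Tendsto (fun j => x (k j + 1) - x (k j)) atTop (𝓝 0) :=
      tendsto_zero_iff_norm_tendsto_zero.2 (hd.comp hktop)
    simpa using h1.add hlim
  have hxs : xs ∈ feasible S :=
    (isClosed_feasible hs.closed).mem_of_tendsto hlim (Eventually.of_forall fun j => hx.mem _)
  obtain ⟨T, hT⟩ : ∃ T : ℝ, ∀ᶠ n in atTop, τ n ≤ T := by
    obtain ⟨T, hT1, hT2⟩ := EReal.lt_iff_exists_real_btwn.1 hτ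
    refine ⟨T, ?_⟩
    filter_upwards [eventually_lt_of_limsup_lt hT1] with n hn
    exact (EReal.coe_lt_coe_iff.1 hn).le
  have hhlim := hx.tendsto_coupling hs hf hg hT hh hd hktop hxs hlim hlim'
  have hratio : Tendsto (fun j => ∑ i, f i (x (k j + 1) i) / g i (x (k j + 1) i)) atTop
      (𝓝 (∑ i, f i (xs i) / g i (xs i))) := by
    obtain ⟨D, hD, -⟩ := exists_hasFDerivAt_neg_sum_ratio hs hf hg hxs
    simpa using (hD.continuousAt.tendsto.comp hlim').neg
  -- `F` is bounded below along the iterates and the ratios converge, so `h` cannot drop to `-∞` in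
  -- the limit.
  have hbot : h xs ≠ ⊥ := by
    have h1 : ∀ᶠ j in atTop, ((Fr (x 0) - (∑ i, f i (xs i) / g i (xs i) + 1) : ℝ) : EReal) ≤
        h (x (k j + 1)) := by
      filter_upwards [hratio.eventually_lt_const (lt_add_one _)] with j hj
      rw [← EReal.coe_toReal (hs.ne_top _) (hfin (k j + 1)), EReal.coe_le_coe_iff]
      have h2 := hF0 (k j + 1)
      have h3 : Fr (x (k j + 1)) = (h (x (k j + 1))).toReal +
        ∑ i, f i (x (k j + 1) i) / g i (x (k j + 1) i) := rfl
      linarith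
    have h2 := ge_of_tendsto hhlim h1
    intro hb
    rw [hb, le_bot_iff] at h2
    exact EReal.coe_ne_bot _ h2
  have hFlim : Tendsto (fun j => Fr (x (k j + 1))) atTop (𝓝 (Fr xs)) :=
    ((EReal.tendsto_toReal (hs.ne_top xs) hbot).comp hhlim).add hratio
  have hL : L = -Fr xs := by
    have h1 : Tendsto (fun j => G (k j + 1)) atTop (𝓝 L) :=
      hGlim.comp ((tendsto_add_atTop_iff_nat 1).2 tendsto_id |>.comp hktop)
    have h2 : Tendsto (fun j => G (k j + 1)) atTop (𝓝 (-Fr xs + νbar * 0 ^ 2)) :=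
      hFlim.neg.add (((hd.comp hktop).pow 2).const_mul νbar)
    simpa using tendsto_nhds_unique h1 h2
  obtain ⟨C, hC, hsub⟩ := hx.exists_small_subgradient hm hs h0 hf hg hT hh hlip hd
  have hprev : Tendsto (fun n => ‖x n - x (n - 1)‖) atTop (𝓝 0) := by
    rw [← tendsto_add_atTop_iff_nat 1]
    simpa using hd
  refine ⟨xs, C + 4 * νbar, ⟨hxs, ?_⟩, hbot, ?_⟩
  -- The small subgradients tend to `0` with convergent values, so `0` is a limiting subgradient;
  -- the shift by `J` discards indices without one.
  · obtain ⟨J, hJ⟩ := eventually_atTop.1 (hktop.eventually hsub)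
    choose! u hu hunorm using hJ
    have hval := negObjective_eq_coe hs hxs hbot
    refine ⟨by rw [hval]; exact EReal.coe_ne_bot _, by rw [hval]; exact EReal.coe_ne_top _,
      fun j => x (k (j + J) + 1), fun j => u (j + J), ?_, ?_, ?_, fun j => hu _ (by omega)⟩
    · exact (tendsto_add_atTop_iff_nat J).2 hlim'
    · rw [hval]
      refine ((continuous_coe_real_ereal.tendsto _).comp
        ((tendsto_add_atTop_iff_nat J).2 hFlim.neg)).congr fun j => ?_
      exact (negObjective_eq_coe hs (hx.mem _) (hfin _)).symm
    · have h1 : Tendsto (fun j => C * (‖x (k j + 1) - x (k j)‖ + ‖x (k j) - x (k j - 1)‖)) atTop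
          (𝓝 0) := by
        simpa using ((hd.comp hktop).add (hprev.comp hktop)).const_mul C
      exact squeeze_zero_norm (fun j => hunorm _ (by omega)) ((tendsto_add_atTop_iff_nat J).2 h1)
  · refine ⟨hc, by positivity, fun n => ?_, ?_, fun n => ?_, ?_, ?_, fun n => ?_, ?_⟩
    · have h1 : L ≤ G n := ciInf_le hGbdd n
      have h2 : G n = -Fr (x n) + νbar * ‖x n - x (n - 1)‖ ^ 2 := rfl
      linarith
    · have h1 := hGlim.add_const (Fr xs)
      rw [hL, neg_add_cancel] at h1
      exact h1
    · have := hdescG n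
      simp only [hG] at this
      linarith
    · exact mapClusterPt_iff_frequently.2 fun s hs' =>
        hktop.frequently (hlim.eventually hs').frequently
    · rw [merit_eq_coe hs hxs hbot]
      simp [hFr]
    · rw [merit_eq_coe hs (hx.mem _) (hfin _)]
      congr 1
      simp [hFr]
    · filter_upwards [(tendsto_add_atTop_nat 1).eventually hsub] with n hn
      obtain ⟨u, hu, hunorm⟩ := hn
      obtain ⟨U, hU, hUnorm⟩ := exists_mem_frechetSubdiff_merit (y' := x (n + 1)) hν hu
      refine ⟨U, hU, hUnorm.trans ?_⟩
      have h1 : 0 ≤ 4 * νbar * ‖x (n + 1) - x n‖ := by positivity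
      simp only [add_tsub_cancel_right] at hunorm
      change ‖u‖ + 4 * νbar * ‖x (n + 2) - x (n + 1)‖ ≤ _
      change ‖u‖ ≤ C * (‖x (n + 2) - x (n + 1)‖ + ‖x (n + 1) - x n‖) at hunorm
      linarith

end Convergence

end SumOfRatios

end

/-! ### Assembly: from merit gaps to objective values. -/

theorem theorem3p2 {m : ℕ} (hm : 1 ≤ m) {H : Fin m → Type*}
    [∀ i, NormedAddCommGroup (H i)] [∀ i, InnerProductSpace ℝ (H i)]
    [∀ i, FiniteDimensional ℝ (H i)]
    (S : ∀ i, Set (H i)) (h : PiLp 2 H → EReal) (f g : ∀ i, H i → ℝ)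
    (a b : Fin m → ℝ) (δ νbar : ℝ) (τ ν : ℕ → ℝ) (x : ℕ → PiLp 2 H)
    (hstand : SumOfRatios.StandingAssumption S h f g a b)
    (hx : SumOfRatios.IsGenerated S h f g a b δ νbar τ ν x)
    (hx0 : h (x 0) ≠ ⊥)
    (hbdd : ∃ M : ℝ, ∀ z ∈ SumOfRatios.feasible S, SumOfRatios.objective h f g z ≤ (M : EReal))
    (hlevel : Bornology.IsBounded {z | z ∈ SumOfRatios.feasible S ∧
      SumOfRatios.objective h f g (x 0) ≤ SumOfRatios.objective h f g z})
    (hf : ∀ i, ∃ O : Set (H i), IsOpen O ∧ S i ⊆ O ∧ ContDiffOn ℝ 1 (f i) O)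
    (hg : ∀ i, ∃ O : Set (H i), IsOpen O ∧ S i ⊆ O ∧ ContDiffOn ℝ 1 (g i) O)
    (hKL : ∀ xbar ∈ SumOfRatios.domSubdiff (SumOfRatios.negObjective S h f g),
      SumOfRatios.KLAt (SumOfRatios.merit S h f g νbar) (WithLp.toLp 2 (xbar, xbar)))
    (hτ : limsup (fun n => (τ n : EReal)) atTop < ⊤)
    (hh : m = 1 ∨ SumOfRatios.HasLipschitzGradientOn h (SumOfRatios.feasible S))
    (hlip : ∃ ε l : ℝ, 0 < ε ∧ 0 < l ∧ ∀ i, ∀ z ∈ S i, ∀ z' ∈ S i, ‖z - z'‖ ≤ ε →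
      ‖gradient (fun y => f i y / g i y) z - gradient (fun y => f i y / g i y) z'‖
        ≤ l * ‖z - z'‖) :
    Summable (fun n => ‖x (n + 1) - x n‖) ∧
    ∃ xstar : PiLp 2 H, Tendsto x atTop (𝓝 xstar) ∧
      SumOfRatios.IsStationary S h f g xstar ∧
      ∀ α : ℝ, 0 ≤ α → α < 1 →
        (∀ xbar ∈ SumOfRatios.domSubdiff (SumOfRatios.negObjective S h f g),
          SumOfRatios.KLAtWithExponent (SumOfRatios.merit S h f g νbar)
            (WithLp.toLp 2 (xbar, xbar)) α) →
        (α = 0 → ∃ n₀ : ℕ, ∀ n ≥ n₀, x n = xstar) ∧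
        (0 < α → α ≤ 1 / 2 → ∃ γ ρ : ℝ, 0 < γ ∧ 0 < ρ ∧ ρ < 1 ∧ ∀ n : ℕ,
          ‖x n - xstar‖ ≤ γ * ρ ^ ((n : ℝ) / 2) ∧
          (SumOfRatios.objective h f g (x n) - SumOfRatios.objective h f g xstar).abs
            ≤ ENNReal.ofReal (γ * ρ ^ n)) ∧
        (1 / 2 < α → ∃ γ : ℝ, 0 < γ ∧ ∀ n : ℕ, 1 ≤ n →
          ‖x n - xstar‖ ≤ γ * (n : ℝ) ^ (-((1 - α) / (2 * α - 1))) ∧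
          (SumOfRatios.objective h f g (x n) - SumOfRatios.objective h f g xstar).abs
            ≤ ENNReal.ofReal (γ * (n : ℝ) ^ (-((2 - 2 * α) / (2 * α - 1))))) := by
  obtain ⟨xs, C, hstat, hbot, hseq⟩ := hx.exists_isDescentSequence hm hstand hx0 hbdd hlevel hf hg
    hτ hh hlip
  have hdom : xs ∈ SumOfRatios.domSubdiff (SumOfRatios.negObjective S h f g) := ⟨0, hstat.2⟩
  obtain ⟨-, φ, hφ⟩ := hKL xs hdom
  obtain ⟨hsum, hlim⟩ := hseq.summable_and_tendsto hφ
  have hfin := hx.ne_bot hm hstand hx0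
  have hc := hseq.c_pos
  have hν := hx.νbar_nonneg
  set r : ℕ → ℝ := fun n => -SumOfRatios.realObjective h f g (x n)
    + νbar * ‖x n - x (n - 1)‖ ^ 2 + SumOfRatios.realObjective h f g xs with hr
  -- `F(x_n) - F(x*)` equals `νbar ‖x_n - x_{n-1}‖² - r n`. The square is at most `r (n - 1) / (δ -
  -- 2 νbar)` by descent, so both terms are controlled by the previous gap.
  set A : ℝ := 1 + νbar / (δ - 2 * νbar) with hA
  have hA1 : 1 ≤ A := by
    have : 0 ≤ νbar / (δ - 2 * νbar) := by positivity
    linarith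
  have hobj : ∀ n, (SumOfRatios.objective h f g (x n) - SumOfRatios.objective h f g xs).abs ≤
      ENNReal.ofReal (A * r (n - 1)) := by
    intro n
    rw [SumOfRatios.objective_eq_coe (hfin n) (hstand.ne_top _),
      SumOfRatios.objective_eq_coe hbot (hstand.ne_top _), ← EReal.coe_sub, EReal.abs_def]
    refine ENNReal.ofReal_le_ofReal ?_
    have h1 : ‖x n - x (n - 1)‖ ^ 2 ≤ r (n - 1) / (δ - 2 * νbar) := by
      cases n with
      | zero =>
        have := hseq.gap_nonneg 0
        simpa using div_nonneg this hc.le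
      | succ n => exact hseq.step_sq_le n
    have h2 : r n ≤ r (n - 1) := hseq.gap_antitone (Nat.sub_le n 1)
    have h3 := hseq.gap_nonneg n
    have h4 : r n = -SumOfRatios.realObjective h f g (x n)
      + νbar * ‖x n - x (n - 1)‖ ^ 2 + SumOfRatios.realObjective h f g xs := rfl
    have h5 : νbar * ‖x n - x (n - 1)‖ ^ 2 ≤ νbar / (δ - 2 * νbar) * r (n - 1) := by
      calc _ ≤ νbar * (r (n - 1) / (δ - 2 * νbar)) := mul_le_mul_of_nonneg_left h1 hν
        _ = _ := by ring
    have h6 : 0 ≤ νbar * ‖x n - x (n - 1)‖ ^ 2 := by positivity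
    have h7 : A * r (n - 1) = r (n - 1) + νbar / (δ - 2 * νbar) * r (n - 1) := by rw [hA]; ring
    rw [abs_le]
    change 0 ≤ r n at h3
    constructor <;> linarith
  refine ⟨hsum, xs, hlim, hstat, fun α hα0 hα1 hexp => ?_⟩
  obtain ⟨-, γ, hγ, hφα⟩ := hexp xs hdom
  refine ⟨?_, fun hpos hhalf => ?_, fun hhalf => ?_⟩
  · rintro rfl
    exact hseq.eventually_eq hφα hlim
  · obtain ⟨B, ρ, hB, hρ0, hρ1, hrate⟩ := hseq.exists_linear_rate hγ hpos hhalf hφα hlim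
    have hAB : B ≤ A * B / ρ := by
      rw [le_div_iff₀ hρ0]
      nlinarith
    -- Passing from `r (n - 1)` to `ρ ^ n` costs a factor `1 / ρ`, which also covers `n = 0`, where
    -- `n - 1 = 0`.
    refine ⟨A * B / ρ, ρ, by positivity, hρ0, hρ1, fun n => ⟨?_, (hobj n).trans ?_⟩⟩
    · exact (hrate n).1.trans (mul_le_mul_of_nonneg_right hAB (by positivity))
    · refine ENNReal.ofReal_le_ofReal ?_
      have h1 : ρ ^ (n - 1) * ρ ≤ ρ ^ n := by
        cases n with
        | zero => simpa using hρ1.le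
        | succ n => simp [pow_succ]
      calc A * r (n - 1) ≤ A * (B * ρ ^ (n - 1)) :=
            mul_le_mul_of_nonneg_left (hrate (n - 1)).2 (by linarith)
        _ = A * B / ρ * (ρ ^ (n - 1) * ρ) := by field_simp
        _ ≤ _ := mul_le_mul_of_nonneg_left h1 (by positivity)
  · obtain ⟨B, hB, hrate⟩ := hseq.exists_sublinear_rate hγ hhalf hα1 hφα hlim
    have hα' : 0 < 2 * α - 1 := by linarith
    refine ⟨A * B, by positivity, fun n hn => ⟨?_, (hobj n).trans ?_⟩⟩
    · have hn0 : (0 : ℝ) < n := by exact_mod_cast hn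
      have h1 : ((n : ℝ) + 1) ^ (-((1 - α) / (2 * α - 1))) ≤
          (n : ℝ) ^ (-((1 - α) / (2 * α - 1))) :=
        Real.rpow_le_rpow_of_nonpos hn0 (by linarith)
          (neg_nonpos.2 (div_nonneg (by linarith) hα'.le))
      exact (hrate n).1.trans (mul_le_mul (by nlinarith) h1 (by positivity) (by positivity))
    · refine ENNReal.ofReal_le_ofReal ?_
      have h1 := (hrate (n - 1)).2
      -- The rate is stated in `n + 1`, so the shift to the previous gap gives exactly a power of
      -- `n`.
      have h2 : ((n - 1 : ℕ) : ℝ) + 1 = n := by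
        rw [Nat.cast_sub hn]
        simp
      rw [h2] at h1
      rw [mul_assoc]
      exact mul_le_mul_of_nonneg_left h1 (by linarith)
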